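/- **Setting.** There are $N$ players. Player $i$ has an action set $\Theta_i\subseteq\mathbb R^n$, a cost function $J_i:\mathbb R^{nN}\to\mathbb R$ of the profile $x=(x_1,\dots,x_N)$, and a parameter set $\mathcal M_i\subseteq\mathbb R^n$, which is convex and compact. Put $\Theta=\prod_i\Theta_i$, let $b=\sum_{i=1}^N b_i\in\mathbb R$, and let $F(x)=(\nabla_{x_i}J_i(x))_{i=1}^N$ be the pseudo-gradient. Assume: 1. each $\Theta_i$ is compact and convex, and there is $x\in\operatorname{relint}\Theta$ with $\sum_{j}\omega_j^{\mathrm T}x_j<b$ for all $\omega_j\in\mathcal M_j$, $j=1,\dots,N$; 2. each $J_i$ is Lipschitz continuous on $\Theta$ and continuously differentiable in $x_i$, and $F$ is strictly monotone and locally Lipschitz continuous on $\Theta$; 3. the communication graph on $\{1,\dots,N\}$ is undirected and connected, with symmetric weights $a_{ij}=a_{ji}$, where $a_{ij}>0$ if $ij$ is an edge and $a_{ij}=0$ otherwise; $L$ is its Laplacian matrix. For each $i$ let $\{\omega\in\mathbb R^n: A_i\omega\le d_i\}$, with $A_i\in\mathbb R^{q_i\times n}$ having unit rows and $d_i\in\mathbb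 R^{q_i}$, be a nonempty polyhedron contained in $\mathcal M_i$ whose vertices lie on the boundary of $\mathcal M_i$. Let either $S_i=\mathbb R^{q_i}$ for all $i$, or $S_i=\mathbb R^{q_i}_+$ for all $i$. Write $z_i=(x_i,\sigma_i)\in\mathbb R^{n}\times\mathbb R^{q_i}$, $z=(z_1,\dots,z_N)$, and put $$\Omega_i=\{(x_i,\sigma_i)\in\Theta_i\times S_i:\ A_i^{\mathrm T}\sigma_i=x_i\},\quad \Omega=\prod_i\Omega_i,\quad (\boldsymbol Bz)_i=d_i^{\mathrm T}\sigma_i,\quad \boldsymbol b=(b_1,\dots,b_N),$$ $$\Xi=\Big\{z\in\Omega:\ \sum_{j=1}^N d_j^{\mathrm T}\sigma_j\le b\Big\},\qquad g(z)=\big((\nabla_{x_i}J_i(x),\,0)\big)_{i=1}^N .$$ Let $\Pi_C$ be the Euclidean projection onto $C$ and $[\,\cdot\,]^+=\Pi_{\mathbb R^N_+}$. Consider the dynamics $$\dot z=\Pi_\Omega\big(z-g(z)-\boldsymbol B^{\mathrm T}\lambda\big)-z,\qquad \dot\lambda=\big[\lambda+\boldsymbol Bz-\boldsymbol b-L\lambda-L\zeta\big]^+-\lambda,\qquad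 \dot\zeta=L\lambda ,$$ with $z(0)\in\Omega$, $\lambda(0)\in\mathbb R^N_+$, $\zeta(0)\in\mathbb R^N$. **Theorem.** Every trajectory $(z(t),\lambda(t),\zeta(t))$, $t\ge 0$, of the dynamics is bounded and converges, as $t\to\infty$, to an equilibrium point $(z^*,\lambda^*,\zeta^*)$ of the dynamics. The limit $z^*$ is a solution of $\mathrm{VI}(\Xi,g)$, that is, $z^*\in\Xi$ and $(y-z^*)^{\mathrm T}g(z^*)\ge0$ for all $y\in\Xi$. Moreover $z^*\in\Omega$ and $\lambda^*\in\mathbb R^N_+$ satisfy the first-order conditions $$0\in g(z^*)+\boldsymbol B^{\mathrm T}\lambda^*+\mathcal N_\Omega(z^*),\qquad (\boldsymbol Bz^*-\boldsymbol b)^{\mathrm T}\boldsymbol 1_N\le 0,\qquad (\boldsymbol Bz^*-\boldsymbol b)^{\mathrm T}\lambda^*=0,\qquad L\lambda^*=0,$$ where $\mathcal N_\Omega(z^*)$ is the normal cone of $\Omega$ at $z^*$. -/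

import Mathlib

open Set Filter Topology
open scoped Matrix

/-! ## Generic notions: projection, variational inequality, normal cone -/

/-- `ℝᵐ` with its Euclidean norm. -/
abbrev Euc (m : ℕ) : Type := EuclideanSpace ℝ (Fin m)

/-- `ℝ₊ᵐ`. -/
def nonnegOrthant (m : ℕ) : Set (Euc m) := {x | ∀ k, 0 ≤ x k}

/-- The projection `Π_C(x) = argmin_{y ∈ C} ‖x - y‖` (a minimiser exists when `C` is nonempty and
closed, see `projOnto_spec`; it is unique when `C` is moreover convex). -/
noncomputable def projOnto {V : Type*} [NormedAddCommGroup V] (C : Set V) (x : V) : V :=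
  Classical.epsilon fun y => y ∈ C ∧ ∀ w ∈ C, ‖x - y‖ ≤ ‖x - w‖

theorem projOnto_spec {V : Type*} [NormedAddCommGroup V] [ProperSpace V] {C : Set V}
    (hne : C.Nonempty) (hcl : IsClosed C) (x : V) :
    projOnto C x ∈ C ∧ ∀ w ∈ C, ‖x - projOnto C x‖ ≤ ‖x - w‖ := by
  have h : ∃ y, y ∈ C ∧ ∀ w ∈ C, ‖x - y‖ ≤ ‖x - w‖ := by
    obtain ⟨y, hy, hxy⟩ := hcl.exists_infDist_eq_dist hne x
    refine ⟨y, hy, fun w hw => ?_⟩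
    rw [← dist_eq_norm, ← dist_eq_norm, ← hxy]
    exact Metric.infDist_le_dist_of_mem hw
  exact Classical.epsilon_spec h

/-- `SOL(K, F)`: the solutions of the variational inequality `VI(K, F)`. -/
def solVI {V : Type*} [NormedAddCommGroup V] [InnerProductSpace ℝ V] (K : Set V) (F : V → V) :
    Set V :=
  {x | x ∈ K ∧ ∀ y ∈ K, 0 ≤ inner ℝ (y - x) (F x)}

/-- The normal cone of the convex set `C` at the point `x ∈ C`. -/
def normalConeAt {V : Type*} [NormedAddCommGroup V] [InnerProductSpace ℝ V] (C : Set V) (x : V) :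
    Set V :=
  {v | ∀ y ∈ C, inner ℝ v (y - x) ≤ 0}

/-- `F` is strictly monotone on `K`. -/
def StrictlyMonotoneOn {V : Type*} [NormedAddCommGroup V] [InnerProductSpace ℝ V] (F : V → V)
    (K : Set V) : Prop :=
  ∀ x ∈ K, ∀ y ∈ K, x ≠ y → 0 < inner ℝ (F x - F y) (x - y)

/-! ## The game, its polyhedral approximation and the communication network -/

/-- Action profiles `x = col{x₁, …, x_N} ∈ ℝ^{nN}`. -/
abbrev Profile (N n : ℕ) : Type := PiLp 2 fun _ : Fin N => Euc n

/-- The data of the problem (no properties are imposed here). -/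
structure GameData (N n : ℕ) where
  /-- the local action sets -/
  Θ : Fin N → Set (Euc n)
  /-- the cost functions `Jᵢ(xᵢ, x₋ᵢ)` -/
  J : Fin N → Profile N n → ℝ
  /-- the uncertainty sets of the parameters `ωᵢ` -/
  M : Fin N → Set (Euc n)
  /-- the splitting `b₁, …, b_N` of the right-hand side `b = ∑ bᵢ` of the coupled constraint -/
  bloc : Euc N
  /-- the number of hyperplanes of the `i`th polyhedron -/
  q : Fin N → ℕ
  /-- the normal vectors of the `i`th polyhedron (as rows) -/
  A : ∀ i, Matrix (Fin (q i)) (Fin n) ℝ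
  /-- the offsets of the hyperplanes of the `i`th polyhedron -/
  d : ∀ i, Euc (q i)
  /-- the set in which the dual variable `σᵢ` ranges -/
  Sdual : ∀ i, Set (Euc (q i))
  /-- the communication graph -/
  graph : SimpleGraph (Fin N)
  /-- the weighted adjacency matrix of the communication graph -/
  adj : Matrix (Fin N) (Fin N) ℝ

namespace GameData

variable {N n : ℕ} (G : GameData N n)

/-- The bound `b` of the coupled constraint. -/
noncomputable def b : ℝ := ∑ i, G.bloc i

/-- `Θ = ∏ Θᵢ`. -/
def ThetaProd : Set (Profile N n) := {x | ∀ i, x i ∈ G.Θ i}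

/-- The profile `(u, x₋ᵢ)`. -/
def replace (x : Profile N n) (i : Fin N) (u : Euc n) : Profile N n :=
  WithLp.toLp 2 (Function.update x.ofLp i u)

/-- `∇_{xᵢ} Jᵢ(·, x₋ᵢ)` at `xᵢ`. -/
noncomputable def partialGrad (i : Fin N) (x : Profile N n) : Euc n :=
  gradient (fun u => G.J i (replace x i u)) (x i)

/-- The pseudo-gradient `F`. -/
noncomputable def pseudoGrad (x : Profile N n) : Profile N n :=
  WithLp.toLp 2 fun i => G.partialGrad i x

/-- The polyhedron `{ω | Aᵢ ω ≤ dᵢ}`. -/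
def polyhedron (i : Fin N) : Set (Euc n) :=
  {ω | ∀ k, (G.A i *ᵥ ω.ofLp) k ≤ G.d i k}

/-- The Laplacian matrix of the network. -/
noncomputable def laplacian : Matrix (Fin N) (Fin N) ℝ :=
  Matrix.diagonal (fun i => ∑ j, G.adj i j) - G.adj

/-- The standing assumptions on the game and on the network. -/
structure Standing : Prop where
  Theta_compact : ∀ i, IsCompact (G.Θ i)
  Theta_convex : ∀ i, Convex ℝ (G.Θ i)
  M_compact : ∀ i, IsCompact (G.M i)
  M_convex : ∀ i, Convex ℝ (G.M i)
  /-- the Slater point -/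
  slater : ∃ x ∈ intrinsicInterior ℝ G.ThetaProd,
    ∀ ω : Fin N → Euc n, (∀ j, ω j ∈ G.M j) → ∑ j, inner ℝ (ω j) (x j) < G.b
  J_lipschitz : ∀ i, ∃ K, LipschitzOnWith K (G.J i) G.ThetaProd
  J_contDiff : ∀ i x, ContDiff ℝ 1 fun u => G.J i (replace x i u)
  F_strictMono : StrictlyMonotoneOn G.pseudoGrad G.ThetaProd
  /-- the graph is undirected (as every `SimpleGraph`) and connected -/
  graph_connected : G.graph.Connected
  adj_symm : ∀ i j, G.adj i j = G.adj j i
  adj_pos : ∀ i j, G.graph.Adj i j → 0 < G.adj i j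
  adj_zero : ∀ i j, ¬ G.graph.Adj i j → G.adj i j = 0

/-- `{ω | Aᵢ ω ≤ dᵢ}` is, for every `i`, a (nonempty) polyhedron inscribed in `Mᵢ`: it lies in `Mᵢ`
and its vertices lie on the boundary of `Mᵢ`; the rows of `Aᵢ` are normalized. -/
structure Inscribed : Prop where
  rows_normalized : ∀ i k, ∑ l, G.A i k l ^ 2 = 1
  nonempty : ∀ i, (G.polyhedron i).Nonempty
  subset : ∀ i, G.polyhedron i ⊆ G.M i
  vertices : ∀ i, (G.polyhedron i).extremePoints ℝ ⊆ frontier (G.M i)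

/-! ## The extended certain game -/

/-- `zᵢ = col{xᵢ, σᵢ} ∈ ℝ^{n + qᵢ}`. -/
abbrev ZLoc (i : Fin N) : Type := WithLp 2 (Euc n × Euc (G.q i))

/-- `z = col{z₁, …, z_N} ∈ ℝ^{nN + q}`. -/
abbrev Z : Type := PiLp 2 fun i => G.ZLoc i

/-- The `x`-part of `z`. -/
def xPart (z : G.Z) : Profile N n := WithLp.toLp 2 fun i => (z i).fst

/-- `Φᵢ`. -/
def Phi (i : Fin N) : Set (G.ZLoc i) := {z | z.fst ∈ G.Θ i ∧ z.snd ∈ G.Sdual i}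

/-- `Cᵢ = [-Iₙ, Aᵢᵀ]`. -/
def C (i : Fin N) (z : G.ZLoc i) : Euc n :=
  WithLp.toLp 2 (- z.fst.ofLp + (G.A i)ᵀ *ᵥ z.snd.ofLp)

/-- `Ωᵢ = Φᵢ ∩ {Cᵢ zᵢ = 0}`. -/
def OmegaLoc (i : Fin N) : Set (G.ZLoc i) := {z | z ∈ G.Phi i ∧ G.C i z = 0}

/-- `Ω = ∏ Ωᵢ`. -/
def Omega : Set G.Z := {z | ∀ i, z i ∈ G.OmegaLoc i}

/-- `B = Diag(B₁, …, B_N)` with `Bᵢ = [0, dᵢᵀ]`. -/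
noncomputable def B (z : G.Z) : Euc N := WithLp.toLp 2 fun i => inner ℝ (G.d i) (z i).snd

/-- `Bᵀ`. -/
noncomputable def BT (lam : Euc N) : G.Z :=
  WithLp.toLp 2 fun i => WithLp.toLp 2 ((0 : Euc n), lam i • G.d i)

/-- The pseudo-gradient `g` of the extended game. -/
noncomputable def g (z : G.Z) : G.Z :=
  WithLp.toLp 2 fun i => WithLp.toLp 2 (G.partialGrad i (G.xPart z), (0 : Euc (G.q i)))

/-- The feasible set `Ξ`: the points of `Ω` that satisfy the shared constraint. -/
def Xi : Set G.Z := {z | z ∈ G.Omega ∧ ∑ j, G.B z j ≤ G.b}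

/-- `v ↦ L v`. -/
noncomputable def lap (v : Euc N) : Euc N := WithLp.toLp 2 (G.laplacian *ᵥ v.ofLp)

/-- The first order conditions of `VI(Ξ, g)` for `z` with the multiplier `lam ∈ ℝ₊ᴺ`. -/
structure FirstOrder (z : G.Z) (lam : Euc N) : Prop where
  lam_nonneg : lam ∈ nonnegOrthant N
  mem : z ∈ G.Omega
  stationary : - (G.g z + G.BT lam) ∈ normalConeAt G.Omega z
  feasible : ∑ i, (G.B z - G.bloc) i ≤ 0
  complementary : inner ℝ (G.B z - G.bloc) lam = 0
  consensus : G.lap lam = 0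

/-! ## The projected dynamics -/

/-- Right-hand side of the `z`-equation. -/
noncomputable def rhsZ (z : G.Z) (lam : Euc N) : G.Z :=
  projOnto G.Omega (z - G.g z - G.BT lam) - z

/-- Right-hand side of the `λ`-equation. -/
noncomputable def rhsLam (z : G.Z) (lam zeta : Euc N) : Euc N :=
  projOnto (nonnegOrthant N) (lam + G.B z - G.bloc - G.lap lam - G.lap zeta) - lam

/-- `(z, λ, ζ)` is a trajectory of the dynamics on `[0, ∞)`. -/
structure IsTrajectory (z : ℝ → G.Z) (lam zeta : ℝ → Euc N) : Prop where
  z_init : z 0 ∈ G.Omega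
  lam_init : lam 0 ∈ nonnegOrthant N
  z_deriv : ∀ t, 0 ≤ t → HasDerivWithinAt z (G.rhsZ (z t) (lam t)) (Ici 0) t
  lam_deriv : ∀ t, 0 ≤ t → HasDerivWithinAt lam (G.rhsLam (z t) (lam t) (zeta t)) (Ici 0) t
  zeta_deriv : ∀ t, 0 ≤ t → HasDerivWithinAt zeta (G.lap (lam t)) (Ici 0) t

/-- `(z, λ, ζ)` is an equilibrium point of the dynamics. -/
structure IsEquilibrium (z : G.Z) (lam zeta : Euc N) : Prop where
  z_eq : G.rhsZ z lam = 0
  lam_eq : G.rhsLam z lam zeta = 0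
  zeta_eq : G.lap lam = 0

end GameData

/-!
The dynamics is the projected flow `u' = P (u - T u) - u` for the joint state `u = (z, λ, ζ)`, where
`P` is the projection onto `D = Ω × ℝ₊ᴺ × ℝᴺ` and `T` is the operator of the augmented Lagrangian
(`GameData.stateOp`). `T` is monotone, as the couplings of `z` with `λ` and of `λ` with `ζ` are skew,
and Lipschitz on `D`, as `g` depends only on the action profile, which ranges in a compact set.

*Lyapunov function.* For a solution `p` of the variational inequality of `T` on `D`, the sum of
`‖u - p‖² / 2` and the regularized gap `max_{y ∈ D} (⟪T u, u - y⟫ - ‖u - y‖² / 2)` has upper right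
derivative at most `-⟪T u, u - p⟫ ≤ 0` along the flow (`eventually_slope_gapLyapunov_lt`). Only
difference quotients are used, as `T` need not be differentiable. So trajectories are bounded, and
pointwise ultrafilter limits of their time translates are again solutions, on which `⟪T u, u - p⟫`
vanishes (`IsProjSolution.inner_limit_le_zero`). If such a limit is an equilibrium, it can serve as
`p`, and the whole trajectory converges to it (`IsProjSolution.tendsto_of_ultrafilter`).

*Existence of `p`.* The feasible action profiles form a compact convex set, by closedness of finitely
generated cones; a monotone Lipschitz variational inequality on it has a solution
(`exists_vi_of_monotone`). The affine Farkas lemma turns the robust Slater point into a Slater point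
of the extended game, which yields a scalar multiplier (`exists_multiplier_of_slater`). The
multiplier is distributed to all players, and `ζ` is found in the range of the Laplacian.

*Limits are equilibria.* Along a limit solution strict monotonicity fixes the action profile at that
of `p`, and connectedness makes `λ` consensual, but the dual variables `σ` and the common multiplier
might still rotate. If the load `∑ dⱼᵀ σⱼ` can be brought below `b` at this profile, complementary
slackness forces `λ = 0`. Otherwise the load is at least `b`, so `∑ λᵢ` is nondecreasing along the
limit solution; for a limit chosen to start at `limsup ∑ λᵢ` it is constant, and then the load equals
`b`. In either case `⟪T (v 0), v s⟫` is constant along the limit solution `v`, whereas its derivative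
at `0` is at most `-‖v' 0‖²`; so `v 0` is an equilibrium (`GameData.exists_equilibrium_limit`).
-/

/-! ### Projected dynamics of a monotone operator -/

section ProjectedDynamics

variable {E : Type*} [NormedAddCommGroup E] [InnerProductSpace ℝ E]

/-- `P` is the metric projection onto the convex set `D`, expressed through its variational
characterization. -/
structure IsProjectionOn (P : E → E) (D : Set E) : Prop where
  mem : ∀ v, P v ∈ D
  inner_le : ∀ v, ∀ y ∈ D, inner ℝ (v - P v) (y - P v) ≤ 0

theorem IsProjectionOn.norm_sub_le {P : E → E} {D : Set E} (hP : IsProjectionOn P D) (v w : E) :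
    ‖P v - P w‖ ≤ ‖v - w‖ := by
  have h1 := hP.inner_le v (P w) (hP.mem w)
  have h2 := hP.inner_le w (P v) (hP.mem v)
  have h3 : ‖P v - P w‖ ^ 2 ≤ inner ℝ (v - w) (P v - P w) := by
    rw [← real_inner_self_eq_norm_sq]
    simp only [inner_sub_left, inner_sub_right] at h1 h2 ⊢
    linarith
  have h4 := h3.trans (real_inner_le_norm _ _)
  by_contra hlt
  push Not at hlt
  nlinarith [norm_nonneg (v - w), norm_nonneg (P v - P w)]

/-- The vector field of the projected dynamics `u' = P (u - T u) - u`. -/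
def projField (P T : E → E) (u : E) : E := P (u - T u) - u

/-- `u` is a solution in `D` of the projected dynamics on `[0, ∞)`. -/
structure IsProjSolution (P T : E → E) (D : Set E) (u : ℝ → E) : Prop where
  mem : ∀ t, 0 ≤ t → u t ∈ D
  deriv : ∀ t, 0 ≤ t → HasDerivWithinAt u (projField P T (u t)) (Ici 0) t

theorem IsProjSolution.continuousOn {P T : E → E} {D : Set E} {u : ℝ → E}
    (hu : IsProjSolution P T D u) : ContinuousOn u (Ici 0) :=
  fun t ht => (hu.deriv t ht).continuousWithinAt

/-- The Lyapunov function: half the squared distance to `p` plus Fukushima's regularized gap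
function of the variational inequality. -/
noncomputable def gapLyapunov (P T : E → E) (p u : E) : ℝ :=
  ‖u - p‖ ^ 2 / 2 + (inner ℝ (T u) (u - P (u - T u)) - ‖u - P (u - T u)‖ ^ 2 / 2)

variable {P T : E → E} {D : Set E}

theorem norm_projField_sq_le (hP : IsProjectionOn P D) {u : E} (hu : u ∈ D) :
    ‖projField P T u‖ ^ 2 ≤ inner ℝ (T u) (u - P (u - T u)) := by
  have h := hP.inner_le (u - T u) u hu
  rw [projField, ← norm_neg, neg_sub, ← real_inner_self_eq_norm_sq]
  set H := P (u - T u)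
  simp only [inner_sub_left, inner_sub_right] at h ⊢
  linarith

theorem half_norm_sq_le_gapLyapunov (hP : IsProjectionOn P D) {u p : E} (hu : u ∈ D) :
    ‖u - p‖ ^ 2 / 2 ≤ gapLyapunov P T p u := by
  have h := norm_projField_sq_le (T := T) hP hu
  rw [projField, ← norm_neg, neg_sub] at h
  unfold gapLyapunov
  nlinarith [sq_nonneg ‖u - P (u - T u)‖]

/-- The point `P (u - T u)` maximizes `y ↦ ⟪T u, u - y⟫ - ‖u - y‖² / 2` over `D`. -/
theorem le_gap (hP : IsProjectionOn P D) {u y : E} (hy : y ∈ D) :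
    inner ℝ (T u) (u - y) - ‖u - y‖ ^ 2 / 2 ≤
      inner ℝ (T u) (u - P (u - T u)) - ‖u - P (u - T u)‖ ^ 2 / 2 := by
  have h := hP.inner_le (u - T u) y hy
  set H := P (u - T u)
  have h2 : 0 ≤ ‖y - H‖ ^ 2 := sq_nonneg _
  simp only [← real_inner_self_eq_norm_sq, inner_sub_left, inner_sub_right,
    real_inner_comm u y, real_inner_comm u H, real_inner_comm H y] at *
  linarith

theorem norm_projField_sub_le (hP : IsProjectionOn P D) {K : NNReal} (hT : LipschitzOnWith K T D)
    {u v : E} (hu : u ∈ D) (hv : v ∈ D) :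
    ‖projField P T u - projField P T v‖ ≤ (2 + K) * ‖u - v‖ := by
  have h1 := hP.norm_sub_le (u - T u) (v - T v)
  have h2 := hT.norm_sub_le hu hv
  have h3 : ‖(u - T u) - (v - T v)‖ ≤ ‖u - v‖ + ‖T u - T v‖ := by
    rw [sub_sub_sub_comm]; exact norm_sub_le _ _
  have h4 : ‖projField P T u - projField P T v‖ ≤ ‖P (u - T u) - P (v - T v)‖ + ‖u - v‖ := by
    unfold projField
    rw [sub_sub_sub_comm]; exact norm_sub_le _ _
  linarith

theorem vi_of_projField_eq_zero (hP : IsProjectionOn P D) {p : E} (h : projField P T p = 0) :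
    p ∈ D ∧ ∀ y ∈ D, 0 ≤ inner ℝ (T p) (y - p) := by
  have h' : P (p - T p) = p := sub_eq_zero.1 h
  refine ⟨h' ▸ hP.mem _, fun y hy => ?_⟩
  have := hP.inner_le (p - T p) y hy
  rw [h', sub_sub_cancel_left, inner_neg_left] at this
  linarith

/-- Differential inequality for the Lyapunov function along a solution. As `T` is only Lipschitz,
the regularized gap need not be differentiable; its difference quotients are bounded by comparing
both gap values at the later projection point, and monotonicity of `T` disposes of the
second order term. -/
theorem eventually_slope_gapLyapunov_lt (hP : IsProjectionOn P D) {K : NNReal}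
    (hT : LipschitzOnWith K T D) (hmono : ∀ u ∈ D, ∀ v ∈ D, 0 ≤ inner ℝ (T u - T v) (u - v))
    {p : E} (hp : p ∈ D) {u : ℝ → E} (hu : IsProjSolution P T D u) {t : ℝ} (ht : 0 ≤ t) {r : ℝ}
    (hr : -inner ℝ (T (u t)) (u t - p) < r) :
    ∀ᶠ s in 𝓝[>] t, slope (fun s => gapLyapunov P T p (u s)) t s < r := by
  have hd : Tendsto (slope u t) (𝓝[>] t) (𝓝 (projField P T (u t))) :=
    (hasDerivWithinAt_iff_tendsto_slope' self_notMem_Ioi).1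
      ((hu.deriv t ht).mono (Ioi_subset_Ici ht))
  have hc : Tendsto u (𝓝[>] t) (𝓝 (u t)) :=
    ((hu.deriv t ht).mono (Ioi_subset_Ici ht)).continuousWithinAt
  have hev : ∀ᶠ s in 𝓝[>] t, t < s := self_mem_nhdsWithin
  have hmem : ∀ᶠ s in 𝓝[>] t, u s ∈ D := hev.mono fun s hs => hu.mem s (ht.trans hs.le)
  have hF : Tendsto (fun s => projField P T (u s)) (𝓝[>] t) (𝓝 (projField P T (u t))) := by
    rw [tendsto_iff_norm_sub_tendsto_zero]
    have h0 : Tendsto (fun s => (2 + (K : ℝ)) * ‖u s - u t‖) (𝓝[>] t) (𝓝 0) := by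
      simpa using (tendsto_iff_norm_sub_tendsto_zero.1 hc).const_mul (2 + (K : ℝ))
    exact squeeze_zero' (Eventually.of_forall fun _ => norm_nonneg _)
      (hmem.mono fun s hs => norm_projField_sub_le hP hT hs (hu.mem t ht)) h0
  have hH : Tendsto (fun s => P (u s - T (u s))) (𝓝[>] t) (𝓝 (P (u t - T (u t)))) := by
    simpa [projField] using hF.add hc
  set H := P (u t - T (u t)) with hHdef
  have hf : projField P T (u t) = H - u t := rfl
  rw [hf] at hd hF
  -- the upper bound for the difference quotient and its limit
  have hR : Tendsto (fun s => K * ‖slope u t s‖ * ‖slope u t s - projField P T (u s)‖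
      + inner ℝ (T (u t)) (slope u t s) - inner ℝ (slope u t s) (u t - P (u s - T (u s)))
      + inner ℝ (slope u t s) (u t - p)) (𝓝[>] t)
      (𝓝 (K * ‖H - u t‖ * ‖(H - u t) - (H - u t)‖ + inner ℝ (T (u t)) (H - u t)
        - inner ℝ (H - u t) (u t - H) + inner ℝ (H - u t) (u t - p))) :=
    ((((hd.norm.const_mul _).mul (hd.sub hF).norm).add (tendsto_const_nhds.inner hd)).sub
      (hd.inner (tendsto_const_nhds.sub hH))).add (hd.inner tendsto_const_nhds)
  have hlim : K * ‖H - u t‖ * ‖(H - u t) - (H - u t)‖ + inner ℝ (T (u t)) (H - u t)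
        - inner ℝ (H - u t) (u t - H) + inner ℝ (H - u t) (u t - p) < r := by
    have h := hP.inner_le (u t - T (u t)) p hp
    rw [← hHdef] at h
    refine lt_of_le_of_lt ?_ hr
    rw [sub_self, norm_zero, mul_zero, zero_add]
    simp only [inner_sub_left, inner_sub_right, real_inner_comm (u t) H] at h ⊢
    linarith
  filter_upwards [hR.eventually_lt_const hlim, hmem, hev] with s hs hsD hts
  refine lt_of_le_of_lt ?_ hs
  have hpos : 0 < s - t := sub_pos.2 hts
  have hsl : u s - u t = (s - t) • slope u t s := (sub_smul_slope u t s).symm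
  set d := slope u t s
  have hsl' : u s = u t + (s - t) • d := by rw [← hsl]; abel
  set H' := P (u s - T (u s)) with hH'
  have hgap := le_gap (T := T) hP (u := u t) (y := H') (hP.mem _)
  have hm : 0 ≤ inner ℝ (T (u s) - T (u t)) d := by
    have := hmono _ hsD _ (hu.mem t ht)
    rw [hsl, inner_smul_right] at this
    exact nonneg_of_mul_nonneg_right this hpos
  have hlip : inner ℝ (T (u s) - T (u t)) (d - projField P T (u s)) ≤
      (s - t) * (K * ‖d‖ * ‖d - projField P T (u s)‖) := by
    have h1 := hT.norm_sub_le hsD (hu.mem t ht)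
    rw [hsl, norm_smul, Real.norm_of_nonneg hpos.le] at h1
    calc _ ≤ ‖T (u s) - T (u t)‖ * ‖d - projField P T (u s)‖ := real_inner_le_norm _ _
      _ ≤ (K * ((s - t) * ‖d‖)) * ‖d - projField P T (u s)‖ := by gcongr
      _ = _ := by ring
  rw [slope_def_field, div_le_iff₀ hpos]
  have hfs : projField P T (u s) = H' - u s := rfl
  have e1 : inner ℝ (T (u s)) (u s - H') - inner ℝ (T (u t)) (u t - H')
      = inner ℝ (T (u s) - T (u t)) (d - projField P T (u s)) - inner ℝ (T (u s) - T (u t)) d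
        + (s - t) * inner ℝ (T (u t)) d := by
    rw [← inner_smul_right _ _ (s - t), ← hsl, hfs]
    simp only [inner_sub_left, inner_sub_right]
    ring
  have e2 : ‖u s - p‖ ^ 2 / 2 - ‖u t - p‖ ^ 2 / 2 - ‖u s - H'‖ ^ 2 / 2 + ‖u t - H'‖ ^ 2 / 2
      = (s - t) * (- inner ℝ d (u t - H') + inner ℝ d (u t - p)) := by
    have : (s - t) * (- inner ℝ d (u t - H') + inner ℝ d (u t - p))
        = - inner ℝ ((s - t) • d) (u t - H') + inner ℝ ((s - t) • d) (u t - p) := by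
      rw [real_inner_smul_left, real_inner_smul_left]; ring
    rw [this, ← hsl]
    simp only [← real_inner_self_eq_norm_sq, inner_sub_left, inner_sub_right,
      real_inner_comm (u t) (u s), real_inner_comm (u t) H', real_inner_comm (u s) H',
      real_inner_comm (u t) p, real_inner_comm (u s) p]
    ring
  unfold gapLyapunov
  rw [← hHdef, ← hH']
  rw [← hHdef] at hgap
  nlinarith

theorem continuousOn_gapLyapunov (hP : IsProjectionOn P D) {K : NNReal}
    (hT : LipschitzOnWith K T D) (p : E) : ContinuousOn (gapLyapunov P T p) D := by
  have hTc := hT.continuousOn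
  have hPc : Continuous P :=
    (LipschitzWith.of_dist_le_mul (K := 1) fun v w => by
      simpa [dist_eq_norm] using hP.norm_sub_le v w).continuous
  have hPu : ContinuousOn (fun u => P (u - T u)) D := hPc.comp_continuousOn (continuousOn_id.sub hTc)
  unfold gapLyapunov
  exact ((((continuousOn_id.sub continuousOn_const).norm.pow 2).div_const 2).add
    ((hTc.inner (continuousOn_id.sub hPu)).sub (((continuousOn_id.sub hPu).norm.pow 2).div_const 2)))

/-- Every solution `p` of the variational inequality of `T` on `D` makes the Lyapunov function
nonincreasing along solutions. -/
theorem antitoneOn_gapLyapunov (hP : IsProjectionOn P D) {K : NNReal}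
    (hT : LipschitzOnWith K T D) (hmono : ∀ u ∈ D, ∀ v ∈ D, 0 ≤ inner ℝ (T u - T v) (u - v))
    {p : E} (hp : p ∈ D) (hvi : ∀ y ∈ D, 0 ≤ inner ℝ (T p) (y - p))
    {u : ℝ → E} (hu : IsProjSolution P T D u) :
    AntitoneOn (fun s => gapLyapunov P T p (u s)) (Ici 0) := by
  intro a ha b hb hab
  have hc : ContinuousOn (fun s => gapLyapunov P T p (u s)) (Ici 0) :=
    (continuousOn_gapLyapunov hP hT p).comp hu.continuousOn fun t ht => hu.mem t ht
  refine image_le_of_liminf_slope_right_le_deriv_boundary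
    (B := fun _ => gapLyapunov P T p (u a)) (B' := fun _ => 0) (a := a) (b := b)
    (hc.mono fun x hx => (mem_Ici.1 ha).trans hx.1) le_rfl continuousOn_const
    (fun x _ => hasDerivWithinAt_const _ _ _) ?_ (right_mem_Icc.2 hab)
  intro x hx r hr
  have hx0 : 0 ≤ x := (mem_Ici.1 ha).trans hx.1
  refine (eventually_slope_gapLyapunov_lt hP hT hmono hp hu hx0 (lt_of_le_of_lt ?_ hr)).frequently
  have h1 := hmono _ (hu.mem x hx0) _ hp
  have h2 := hvi _ (hu.mem x hx0)
  rw [inner_sub_left] at h1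
  linarith

/-- Along a solution with constant Lyapunov function the dissipation vanishes. -/
theorem inner_le_zero_of_gapLyapunov_const (hP : IsProjectionOn P D) {K : NNReal}
    (hT : LipschitzOnWith K T D) (hmono : ∀ u ∈ D, ∀ v ∈ D, 0 ≤ inner ℝ (T u - T v) (u - v))
    {p : E} (hp : p ∈ D) {u : ℝ → E} (hu : IsProjSolution P T D u) {c : ℝ}
    (hc : ∀ s, 0 ≤ s → gapLyapunov P T p (u s) = c) {t : ℝ} (ht : 0 ≤ t) :
    inner ℝ (T (u t)) (u t - p) ≤ 0 := by
  by_contra! hlt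
  have h := eventually_slope_gapLyapunov_lt hP hT hmono hp hu ht (neg_neg_of_pos hlt)
  obtain ⟨s, hs, hts⟩ := (h.and self_mem_nhdsWithin).exists
  rw [slope_def_field, hc s (ht.trans (le_of_lt hts)), hc t ht, sub_self, zero_div] at hs
  exact lt_irrefl _ hs

theorem IsProjSolution.norm_sub_le (hP : IsProjectionOn P D) {K : NNReal}
    (hT : LipschitzOnWith K T D) (hmono : ∀ u ∈ D, ∀ v ∈ D, 0 ≤ inner ℝ (T u - T v) (u - v))
    {p : E} (hp : p ∈ D) (hvi : ∀ y ∈ D, 0 ≤ inner ℝ (T p) (y - p))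
    {u : ℝ → E} (hu : IsProjSolution P T D u) {t : ℝ} (ht : 0 ≤ t) :
    ‖u t - p‖ ≤ √(2 * gapLyapunov P T p (u 0)) := by
  apply Real.le_sqrt_of_sq_le
  have h1 := half_norm_sq_le_gapLyapunov (T := T) (p := p) hP (hu.mem t ht)
  have h2 := antitoneOn_gapLyapunov hP hT hmono hp hvi hu (mem_Ici.2 le_rfl) (mem_Ici.2 ht) ht
  simp only at h2
  linarith

/-- A bounded solution satisfies the first order Taylor estimate with a uniform constant, so that
pointwise limits of its time translates are again solutions. -/
theorem IsProjSolution.exists_taylor_bound (hP : IsProjectionOn P D) {K : NNReal}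
    (hT : LipschitzOnWith K T D) {p : E} (hp : p ∈ D) {R : ℝ}
    {u : ℝ → E} (hu : IsProjSolution P T D u) (hR : ∀ t, 0 ≤ t → ‖u t - p‖ ≤ R) :
    ∃ C, ∀ s, 0 ≤ s → ∀ t, 0 ≤ t →
      ‖u t - u s - (t - s) • projField P T (u s)‖ ≤ C * (t - s) ^ 2 := by
  set C := ‖projField P T p‖ + (2 + K) * R
  have hC : ∀ t, 0 ≤ t → ‖projField P T (u t)‖ ≤ C := fun t ht => by
    have h1 := norm_projField_sub_le hP hT (hu.mem t ht) hp
    have h2 := norm_sub_norm_le (projField P T (u t)) (projField P T p)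
    have h3 : (2 + (K : ℝ)) * ‖u t - p‖ ≤ (2 + K) * R := by gcongr; exact hR t ht
    linarith
  have hlip : ∀ s, 0 ≤ s → ∀ t, 0 ≤ t → ‖u t - u s‖ ≤ C * |t - s| := fun s hs t ht =>
    (convex_Ici (0 : ℝ)).norm_image_sub_le_of_norm_hasDerivWithin_le
      (fun x hx => hu.deriv x hx) hC hs ht
  refine ⟨(2 + K) * C, fun s hs t ht => ?_⟩
  have hsub : uIcc s t ⊆ Ici 0 := fun x hx => (le_min hs ht).trans hx.1
  have key := (convex_uIcc s t).norm_image_sub_le_of_norm_hasDerivWithin_le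
    (f := fun x => u x - x • projField P T (u s))
    (f' := fun x => projField P T (u x) - (1 : ℝ) • projField P T (u s))
    (C := (2 + K) * (C * |t - s|))
    (fun x hx => ((hu.deriv x (hsub hx)).mono hsub).sub
      ((hasDerivWithinAt_id x _).smul_const _))
    (fun x hx => by
      have hx0 : 0 ≤ x := hsub hx
      rw [one_smul]
      refine (norm_projField_sub_le hP hT (hu.mem x hx0) (hu.mem s hs)).trans ?_
      refine mul_le_mul_of_nonneg_left ((hlip s hs x hx0).trans ?_) (by positivity)
      exact mul_le_mul_of_nonneg_left (abs_sub_left_of_mem_uIcc hx)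
        ((norm_nonneg _).trans (hC 0 le_rfl)))
    left_mem_uIcc right_mem_uIcc
  have e : u t - u s - (t - s) • projField P T (u s)
      = u t - t • projField P T (u s) - (u s - s • projField P T (u s)) := by
    rw [sub_smul]; abel
  rw [e]
  refine key.trans (le_of_eq ?_)
  rw [Real.norm_eq_abs, mul_assoc, mul_assoc, mul_assoc, abs_mul_abs_self, sq]

/-- A pointwise ultrafilter limit of the time translates of a bounded solution is a solution. -/
theorem IsProjSolution.exists_limit_solution [ProperSpace E] (hP : IsProjectionOn P D)
    (hD : IsClosed D) {K : NNReal}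
    (hT : LipschitzOnWith K T D) {p : E} (hp : p ∈ D) {R : ℝ}
    {u : ℝ → E} (hu : IsProjSolution P T D u) (hR : ∀ t, 0 ≤ t → ‖u t - p‖ ≤ R)
    (𝒰 : Ultrafilter ℝ) (h𝒰 : (𝒰 : Filter ℝ) ≤ atTop) :
    ∃ v : ℝ → E, IsProjSolution P T D v ∧
      ∀ s, 0 ≤ s → Tendsto (fun t => u (t + s)) 𝒰 (𝓝 (v s)) := by
  have hev : ∀ᶠ t in (𝒰 : Filter ℝ), 0 ≤ t := h𝒰 (eventually_ge_atTop 0)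
  have hlim : ∀ s, ∃ y, 0 ≤ s → Tendsto (fun t => u (t + s)) 𝒰 (𝓝 y) := fun s => by
    by_cases hs : 0 ≤ s
    · have hb : ∀ᶠ t in (𝒰 : Filter ℝ), u (t + s) ∈ Metric.closedBall p R :=
        hev.mono fun t ht => by
          rw [Metric.mem_closedBall, dist_eq_norm]; exact hR _ (add_nonneg ht hs)
      obtain ⟨y, -, hy⟩ := (isCompact_closedBall p R).ultrafilter_le_nhds
        (𝒰.map fun t => u (t + s)) (le_principal_iff.2 hb)
      exact ⟨y, fun _ => hy⟩
    · exact ⟨0, fun h => absurd h hs⟩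
  choose v hv using hlim
  have hvD : ∀ s, 0 ≤ s → v s ∈ D := fun s hs =>
    hD.mem_of_tendsto (hv s hs) (hev.mono fun t ht => hu.mem _ (add_nonneg ht hs))
  obtain ⟨C, hC⟩ := hu.exists_taylor_bound hP hT hp hR
  refine ⟨v, ⟨hvD, fun s hs => ?_⟩, hv⟩
  have hF : Tendsto (fun t => projField P T (u (t + s))) 𝒰 (𝓝 (projField P T (v s))) := by
    rw [tendsto_iff_norm_sub_tendsto_zero]
    have h0 : Tendsto (fun t => (2 + (K : ℝ)) * ‖u (t + s) - v s‖) 𝒰 (𝓝 0) := by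
      simpa using (tendsto_iff_norm_sub_tendsto_zero.1 (hv s hs)).const_mul (2 + (K : ℝ))
    exact squeeze_zero' (Eventually.of_forall fun _ => norm_nonneg _)
      (hev.mono fun t ht =>
        norm_projField_sub_le hP hT (hu.mem _ (add_nonneg ht hs)) (hvD s hs)) h0
  have hT' : ∀ s', 0 ≤ s' →
      ‖v s' - v s - (s' - s) • projField P T (v s)‖ ≤ C * (s' - s) ^ 2 := fun s' hs' => by
    refine le_of_tendsto (((hv s' hs').sub (hv s hs)).sub (hF.const_smul (s' - s))).norm
      (hev.mono fun t ht => ?_)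
    simpa using hC (t + s) (add_nonneg ht hs) (t + s') (add_nonneg ht hs')
  rw [hasDerivWithinAt_iff_isLittleO]
  refine Asymptotics.IsBigO.trans_isLittleO (g := fun x => (x - s) ^ 2) ?_ ?_
  · refine Asymptotics.IsBigO.of_bound C (eventually_mem_nhdsWithin.mono fun x hx => ?_)
    rw [Real.norm_of_nonneg (sq_nonneg _)]
    exact hT' x hx
  · refine Asymptotics.IsLittleO.mono ?_ nhdsWithin_le_nhds
    have h1 : Tendsto (fun x : ℝ => x - s) (𝓝 s) (𝓝 0) := by
      simpa using (continuous_id.sub continuous_const).tendsto s (f := fun x : ℝ => x - s)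
    have := (Asymptotics.isLittleO_pow_id (𝕜 := ℝ) (n := 2) one_lt_two).comp_tendsto h1
    simpa [Function.comp_def] using this

/-- LaSalle's principle: on a limit solution the dissipation with respect to any solution of the
variational inequality vanishes. -/
theorem IsProjSolution.inner_limit_le_zero (hP : IsProjectionOn P D) {K : NNReal}
    (hT : LipschitzOnWith K T D) (hmono : ∀ u ∈ D, ∀ v ∈ D, 0 ≤ inner ℝ (T u - T v) (u - v))
    {p : E} (hp : p ∈ D) (hvi : ∀ y ∈ D, 0 ≤ inner ℝ (T p) (y - p))
    {u v : ℝ → E} (hu : IsProjSolution P T D u) (hv : IsProjSolution P T D v)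
    {𝒰 : Ultrafilter ℝ} (h𝒰 : (𝒰 : Filter ℝ) ≤ atTop)
    (hlim : ∀ s, 0 ≤ s → Tendsto (fun t => u (t + s)) 𝒰 (𝓝 (v s))) {s : ℝ} (hs : 0 ≤ s) :
    inner ℝ (T (v s)) (v s - p) ≤ 0 := by
  have hanti := antitoneOn_gapLyapunov hP hT hmono hp hvi hu
  have hev : ∀ᶠ t in (𝒰 : Filter ℝ), 0 ≤ t := h𝒰 (eventually_ge_atTop 0)
  set V := fun t => gapLyapunov P T p (u t)
  have hVlim : ∀ r, 0 ≤ r → Tendsto (fun t => V (t + r)) 𝒰 (𝓝 (gapLyapunov P T p (v r))) :=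
    fun r hr => ((continuousOn_gapLyapunov hP hT p _ (hv.mem r hr)).tendsto).comp
      (tendsto_nhdsWithin_iff.2 ⟨hlim r hr, hev.mono fun t ht => hu.mem _ (add_nonneg ht hr)⟩)
  refine inner_le_zero_of_gapLyapunov_const (c := gapLyapunov P T p (v 0)) hP hT hmono hp hv ?_ hs
  intro r hr
  have h0 := hVlim 0 le_rfl
  simp only [add_zero] at h0
  refine le_antisymm ?_ ?_
  · exact le_of_tendsto_of_tendsto (hVlim r hr) h0 (hev.mono fun t ht =>
      hanti (mem_Ici.2 ht) (mem_Ici.2 (add_nonneg ht hr)) (le_add_of_nonneg_right hr))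
  · -- the value at any fixed time bounds all later values, hence their limit
    refine ge_of_tendsto (hVlim r hr) (hev.mono fun t ht => ?_)
    have hge : ∀ᶠ t' in (𝒰 : Filter ℝ), t + r ≤ t' := h𝒰 (eventually_ge_atTop (t + r))
    refine le_of_tendsto h0 (hge.mono fun t' ht' => ?_)
    exact hanti (mem_Ici.2 (add_nonneg ht hr))
      (mem_Ici.2 ((add_nonneg ht hr).trans ht')) ht'

/-- If a bounded solution accumulates at an equilibrium, it converges to it. -/
theorem IsProjSolution.tendsto_of_ultrafilter (hP : IsProjectionOn P D) {K : NNReal}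
    (hT : LipschitzOnWith K T D) (hmono : ∀ u ∈ D, ∀ v ∈ D, 0 ≤ inner ℝ (T u - T v) (u - v))
    {p : E} (hp : projField P T p = 0) {u : ℝ → E} (hu : IsProjSolution P T D u)
    {𝒰 : Ultrafilter ℝ} (h𝒰 : (𝒰 : Filter ℝ) ≤ atTop) (hlim : Tendsto u 𝒰 (𝓝 p)) :
    Tendsto u atTop (𝓝 p) := by
  obtain ⟨hpD, hvi⟩ := vi_of_projField_eq_zero hP hp
  have hanti := antitoneOn_gapLyapunov hP hT hmono hpD hvi hu
  have hev : ∀ᶠ t in (𝒰 : Filter ℝ), 0 ≤ t := h𝒰 (eventually_ge_atTop 0)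
  have hV0 : gapLyapunov P T p p = 0 := by
    have : P (p - T p) = p := sub_eq_zero.1 hp
    simp [gapLyapunov, this]
  have hVlim : Tendsto (fun t => gapLyapunov P T p (u t)) 𝒰 (𝓝 0) := by
    rw [← hV0]
    exact ((continuousOn_gapLyapunov hP hT p _ hpD).tendsto).comp
      (tendsto_nhdsWithin_iff.2 ⟨hlim, hev.mono fun t ht => hu.mem _ ht⟩)
  rw [Metric.tendsto_atTop]
  intro ε hε
  obtain ⟨t, hlt, ht⟩ := ((hVlim.eventually_lt_const (by positivity : 0 < ε ^ 2 / 2)).and hev).exists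
  refine ⟨t, fun s hs => ?_⟩
  have h1 := half_norm_sq_le_gapLyapunov (T := T) (p := p) hP (hu.mem s (ht.trans hs))
  have h2 := hanti (mem_Ici.2 ht) (mem_Ici.2 (ht.trans hs)) hs
  simp only at h2
  rw [dist_eq_norm]
  exact lt_of_pow_lt_pow_left₀ 2 hε.le (by linarith)

/-- The closed convex set `D` is invariant under `u' = w - u` with `w` valued in `D`. -/
theorem mem_of_hasDerivWithinAt_sub {D : Set E} (hD : IsClosed D) (hconv : Convex ℝ D)
    {u w : ℝ → E} (h0 : u 0 ∈ D) (hw : ∀ t, 0 ≤ t → w t ∈ D)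
    (hd : ∀ t, 0 ≤ t → HasDerivWithinAt u (w t - u t) (Ici 0) t) {t : ℝ} (ht : 0 ≤ t) :
    u t ∈ D := by
  by_contra hmem
  obtain ⟨f, c, hf, hc⟩ := geometric_hahn_banach_closed_point hconv hD hmem
  -- `exp s * (f (u s) - c)` is nonincreasing
  have hder : ∀ s ∈ Ici (0 : ℝ), HasDerivWithinAt (fun s => Real.exp s * (f (u s) - c))
      (Real.exp s * (f (w s) - c)) (Ici 0) s := fun s hs => by
    have h1 := (f.hasFDerivAt (x := u s)).comp_hasDerivWithinAt s (hd s hs)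
    have h2 := ((Real.hasDerivAt_exp s).hasDerivWithinAt (s := Ici 0)).mul (h1.sub_const c)
    refine h2.congr_deriv ?_
    simp only [Function.comp_apply, map_sub]
    ring
  have hanti : AntitoneOn (fun s => Real.exp s * (f (u s) - c)) (Ici 0) := by
    refine antitoneOn_of_hasDerivWithinAt_nonpos (f' := fun s => Real.exp s * (f (w s) - c))
      (convex_Ici 0) (fun s hs => (hder s hs).continuousWithinAt)
      (fun s hs => (hder s (interior_subset hs)).mono interior_subset) (fun s hs => ?_)
    exact mul_nonpos_of_nonneg_of_nonpos (Real.exp_pos s).le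
      (sub_nonpos.2 (hf _ (hw s (interior_subset hs))).le)
  have h1 := hanti (mem_Ici.2 le_rfl) (mem_Ici.2 ht) ht
  have h2 := hf _ h0
  have h3 := mul_pos (Real.exp_pos t) (sub_pos.2 hc)
  simp only [Real.exp_zero, one_mul] at h1
  linarith

end ProjectedDynamics

/-! ### Variational inequalities on compact convex sets -/

/-- The minimizing property of `projOnto` turned into the variational characterization. -/
theorem isProjectionOn_projOnto {V : Type*} [NormedAddCommGroup V] [InnerProductSpace ℝ V]
    [ProperSpace V] {C : Set V} (hne : C.Nonempty) (hcl : IsClosed C) (hconv : Convex ℝ C) :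
    IsProjectionOn (projOnto C) C := by
  refine ⟨fun v => (projOnto_spec hne hcl v).1, fun v => ?_⟩
  obtain ⟨hm, hmin⟩ := projOnto_spec hne hcl v
  have : Nonempty C := hne.to_subtype
  refine (norm_eq_iInf_iff_real_inner_le_zero hconv hm).1 (le_antisymm ?_ ?_)
  · exact le_ciInf fun w => hmin w w.2
  · exact ciInf_le ⟨0, by rintro _ ⟨w, rfl⟩; exact norm_nonneg _⟩ (⟨_, hm⟩ : C)

section Existence

variable {E : Type*} [NormedAddCommGroup E] [InnerProductSpace ℝ E]

/-- A strongly monotone Lipschitz variational inequality has a solution: the projected step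
`x ↦ P (x - τ • F x)` is a contraction for a suitable step size `τ`. -/
theorem exists_vi_of_strongly_monotone [CompleteSpace E] {P : E → E} {D : Set E}
    (hP : IsProjectionOn P D) (hD : IsClosed D) (hne : D.Nonempty) {F : E → E} {K : NNReal}
    (hF : LipschitzOnWith K F D) {m : ℝ} (hm : 0 < m)
    (hmono : ∀ u ∈ D, ∀ v ∈ D, m * ‖u - v‖ ^ 2 ≤ inner ℝ (F u - F v) (u - v)) :
    ∃ x ∈ D, ∀ y ∈ D, 0 ≤ inner ℝ (F x) (y - x) := by
  -- with this step the squared contraction factor is at most `1 - τ m`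
  set τ : ℝ := m / ((K : ℝ) ^ 2 + m ^ 2) with hτ
  have hden : 0 < (K : ℝ) ^ 2 + m ^ 2 := by positivity
  have hτ0 : 0 < τ := by positivity
  have hτK : τ * ((K : ℝ) ^ 2 + m ^ 2) = m := by rw [hτ]; field_simp
  have hτm : τ * m ≤ 1 := by
    rw [hτ, div_mul_eq_mul_div, div_le_one hden]; nlinarith [sq_nonneg (K : ℝ)]
  set q : ℝ := √(1 - τ * m)
  have hq1 : q < 1 := by
    rw [Real.sqrt_lt' one_pos]; nlinarith [mul_pos hτ0 hm]
  set Q : NNReal := ⟨q, Real.sqrt_nonneg _⟩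
  set Φ : E → E := fun x => P (x - τ • F x)
  have hmaps : MapsTo Φ D D := fun x _ => hP.mem _
  have hcontr : ContractingWith Q (hmaps.restrict Φ D D) := by
    refine ⟨by exact_mod_cast hq1, LipschitzWith.of_dist_le_mul fun x y => ?_⟩
    rw [Subtype.dist_eq, Subtype.dist_eq, dist_eq_norm, dist_eq_norm]
    change ‖Φ x - Φ y‖ ≤ q * ‖(x : E) - y‖
    refine (hP.norm_sub_le _ _).trans ?_
    have h1 := hmono x x.2 y y.2
    have h2 := hF.norm_sub_le x.2 y.2
    have e : (x : E) - τ • F x - (y - τ • F y) = (x - y) - τ • (F x - F y) := by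
      rw [smul_sub]; abel
    rw [e]
    refine le_of_sq_le_sq ?_ (by positivity)
    rw [mul_pow, Real.sq_sqrt (by linarith), norm_sub_sq_real, inner_smul_right, norm_smul,
      Real.norm_of_nonneg hτ0.le, mul_pow, real_inner_comm]
    have h3 : ‖F x - F y‖ ^ 2 ≤ (K : ℝ) ^ 2 * ‖(x : E) - y‖ ^ 2 := by
      rw [← mul_pow]; exact pow_le_pow_left₀ (norm_nonneg _) h2 2
    have h4 : τ * (m * ‖(x : E) - y‖ ^ 2) ≤ τ * inner ℝ (F x - F y) ((x : E) - y) := by gcongr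
    have h5 : τ ^ 2 * ‖F x - F y‖ ^ 2 ≤ τ * m * ‖(x : E) - y‖ ^ 2 := by
      calc τ ^ 2 * ‖F x - F y‖ ^ 2 ≤ τ ^ 2 * ((K : ℝ) ^ 2 * ‖(x : E) - y‖ ^ 2) := by gcongr
        _ = τ * (τ * (K : ℝ) ^ 2) * ‖(x : E) - y‖ ^ 2 := by ring
        _ ≤ τ * m * ‖(x : E) - y‖ ^ 2 := by
          gcongr
          nlinarith [mul_nonneg hτ0.le (sq_nonneg m)]
    linarith
  obtain ⟨x₀, hx₀⟩ := hne
  obtain ⟨x, hx, hfix, -⟩ :=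
    hcontr.exists_fixedPoint' hD.isComplete hmaps hx₀ (edist_ne_top _ _)
  refine ⟨x, hx, fun y hy => ?_⟩
  have h := hP.inner_le (x - τ • F x) y hy
  have hfix' : P (x - τ • F x) = x := hfix
  rw [hfix', sub_sub_cancel_left, inner_neg_left, real_inner_smul_left] at h
  exact nonneg_of_mul_nonneg_right (by linarith) hτ0

/-- A monotone Lipschitz variational inequality on a compact convex set has a solution, as a
cluster point of the solutions of the regularized inequalities for `F + ε • id`. -/
theorem exists_vi_of_monotone [ProperSpace E] {D : Set E} (hD : IsCompact D)
    (hconv : Convex ℝ D) (hne : D.Nonempty) {F : E → E} {K : NNReal}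
    (hF : LipschitzOnWith K F D) (hmono : ∀ u ∈ D, ∀ v ∈ D, 0 ≤ inner ℝ (F u - F v) (u - v)) :
    ∃ x ∈ D, ∀ y ∈ D, 0 ≤ inner ℝ (F x) (y - x) := by
  have hP := isProjectionOn_projOnto hne hD.isClosed hconv
  have hε : ∀ k : ℕ, ∃ x ∈ D, ∀ y ∈ D,
      0 ≤ inner ℝ (F x + (1 / ((k : ℝ) + 1)) • x) (y - x) := fun k => by
    set ε : ℝ := 1 / ((k : ℝ) + 1)
    have hε0 : 0 < ε := Nat.one_div_pos_of_nat
    have hid : LipschitzOnWith ‖ε‖₊ (fun x : E => ε • x) D :=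
      (lipschitzWith_smul ε).lipschitzOnWith
    refine exists_vi_of_strongly_monotone (F := fun x => F x + ε • x) hP hD.isClosed hne
      (hF.add hid) hε0 fun u hu v hv => ?_
    have e : F u + ε • u - (F v + ε • v) = (F u - F v) + ε • (u - v) := by
      rw [smul_sub]; abel
    rw [e, inner_add_left, real_inner_smul_left, real_inner_self_eq_norm_sq]
    linarith [hmono u hu v hv]
  choose x hxD hx using hε
  obtain ⟨a, ha, φ, hφ, hlim⟩ := hD.tendsto_subseq hxD
  refine ⟨a, ha, fun y hy => ?_⟩
  have hFl : Tendsto (fun k => F (x (φ k))) atTop (𝓝 (F a)) :=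
    ((hF.continuousOn a ha).tendsto).comp
      (tendsto_nhdsWithin_iff.2 ⟨hlim, Eventually.of_forall fun k => hxD _⟩)
  have h0 : Tendsto (fun k => 1 / ((φ k : ℝ) + 1)) atTop (𝓝 0) :=
    (tendsto_one_div_add_atTop_nhds_zero_nat (𝕜 := ℝ)).comp hφ.tendsto_atTop
  have hl := Tendsto.inner (𝕜 := ℝ) (hFl.add (h0.smul hlim)) ((tendsto_const_nhds (x := y)).sub hlim)
  rw [zero_smul, add_zero] at hl
  exact ge_of_tendsto' hl fun k => hx (φ k) y hy

/-- A Lagrange multiplier for one linear inequality under Slater's condition. -/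
theorem exists_multiplier_of_slater {V : Type*} [AddCommGroup V] [Module ℝ V] {W : Set V}
    (hW : Convex ℝ W) (ℓ β : V →ₗ[ℝ] ℝ) {b : ℝ} {z₀ zs : V} (h0 : z₀ ∈ W) (hβ0 : β z₀ < b)
    (hmin : ∀ y ∈ W, β y ≤ b → ℓ zs ≤ ℓ y) :
    ∃ μ, 0 ≤ μ ∧ ∀ y ∈ W, 0 ≤ ℓ y - ℓ zs + μ * (β y - b) := by
  set S : Set ℝ := {r | ∃ y ∈ W, β y < b ∧ r = (ℓ y - ℓ zs) / (b - β y)}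
  have hS : S.Nonempty := ⟨_, z₀, h0, hβ0, rfl⟩
  have hSnn : ∀ r ∈ S, 0 ≤ r := by
    rintro _ ⟨y, hy, hyb, rfl⟩
    exact div_nonneg (sub_nonneg.2 (hmin y hy hyb.le)) (sub_nonneg.2 hyb.le)
  have hbdd : BddBelow S := ⟨0, hSnn⟩
  refine ⟨sInf S, le_csInf hS hSnn, fun y hy => ?_⟩
  rcases lt_trichotomy (β y) b with hlt | heq | hgt
  · have h1 := csInf_le hbdd ⟨y, hy, hlt, rfl⟩
    rw [le_div_iff₀ (sub_pos.2 hlt)] at h1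
    linarith
  · rw [heq, sub_self, mul_zero, add_zero]
    exact sub_nonneg.2 (hmin y hy heq.le)
  · -- any competitor below `b` and `y` have a convex combination exactly on the boundary
    have h1 : (ℓ zs - ℓ y) / (β y - b) ≤ sInf S := by
      refine le_csInf hS ?_
      rintro _ ⟨w, hw, hwb, rfl⟩
      rw [div_le_div_iff₀ (sub_pos.2 hgt) (sub_pos.2 hwb)]
      have hpos : 0 < β y - β w := by linarith
      set a := (β y - b) / (β y - β w)
      set c := (b - β w) / (β y - β w)
      have hac : a + c = 1 := by simp only [a, c]; field_simp; ring
      have ha0 : 0 ≤ a := div_nonneg (by linarith) hpos.le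
      have hc0 : 0 ≤ c := div_nonneg (by linarith) hpos.le
      have ha : a * (β y - β w) = β y - b := div_mul_cancel₀ _ hpos.ne'
      have hc : c * (β y - β w) = b - β w := div_mul_cancel₀ _ hpos.ne'
      have hmem := hW hw hy ha0 hc0 hac
      have hβ : β (a • w + c • y) = b := by
        simp only [map_add, map_smul, smul_eq_mul]
        have : a = 1 - c := by linarith
        rw [this]; linarith
      have h2 := hmin _ hmem hβ.le
      simp only [map_add, map_smul, smul_eq_mul] at h2
      have h3 : 0 ≤ (a * (ℓ w - ℓ zs) + c * (ℓ y - ℓ zs)) * (β y - β w) := by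
        refine mul_nonneg ?_ hpos.le
        have : ℓ zs = a * ℓ zs + c * ℓ zs := by rw [← add_mul, hac, one_mul]
        linarith
      have h4 : (a * (ℓ w - ℓ zs) + c * (ℓ y - ℓ zs)) * (β y - β w)
          = (β y - b) * (ℓ w - ℓ zs) + (b - β w) * (ℓ y - ℓ zs) := by
        rw [← ha, ← hc]; ring
      linarith
    rw [div_le_iff₀ (sub_pos.2 hgt)] at h1
    linarith

end Existence

/-! ### Finitely generated cones and the affine Farkas lemma -/

section Cones

variable {ι V : Type*} [Fintype ι] [NormedAddCommGroup V] [NormedSpace ℝ V]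

/-- Carathéodory's argument: a linear dependence with a positive coefficient can be subtracted from
a nonnegative combination until one of its coefficients vanishes. -/
theorem isClosed_image_nonneg_supported [DecidableEq ι] (f : (ι → ℝ) →ₗ[ℝ] V) (s : Finset ι) :
    IsClosed (f '' {w | (∀ i, 0 ≤ w i) ∧ ∀ i ∉ s, w i = 0}) := by
  induction s using Finset.strongInduction with
  | H s ih =>
  by_cases hinj : ∀ k : ι → ℝ, (∀ i ∉ s, k i = 0) → f k = 0 → k = 0
  · let S : Submodule ℝ (ι → ℝ) :=
      { carrier := {w | ∀ i ∉ s, w i = 0}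
        add_mem' := fun ha hb i hi => by simp [ha i hi, hb i hi]
        zero_mem' := fun i _ => rfl
        smul_mem' := fun c a ha i hi => by simp [ha i hi] }
    have hker : LinearMap.ker (f.domRestrict S) = ⊥ := by
      rw [LinearMap.ker_eq_bot']
      exact fun k hk => Subtype.ext (hinj k k.2 hk)
    have hemb := LinearMap.isClosedEmbedding_of_injective hker
    have hcl : IsClosed {w : S | ∀ i, 0 ≤ (w : ι → ℝ) i} := by
      simp only [ofPred_forall]
      exact isClosed_iInter fun i => isClosed_le continuous_const
        ((continuous_apply i).comp continuous_subtype_val)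
    convert hemb.isClosedMap _ hcl using 1
    ext y
    constructor
    · rintro ⟨w, ⟨hw1, hw2⟩, rfl⟩
      exact ⟨⟨w, hw2⟩, hw1, rfl⟩
    · rintro ⟨w, hw, rfl⟩
      exact ⟨w, ⟨hw, w.2⟩, rfl⟩
  · obtain ⟨k, hks, hfk, hkpos⟩ : ∃ k : ι → ℝ, (∀ i ∉ s, k i = 0) ∧ f k = 0 ∧ ∃ i, 0 < k i := by
      push Not at hinj
      obtain ⟨k, hks, hfk, hk⟩ := hinj
      obtain ⟨i, hi⟩ := Function.ne_iff.1 hk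
      rcases lt_or_gt_of_ne hi with h | h
      · exact ⟨-k, fun j hj => by simp [hks j hj], by simp [hfk], i, neg_pos.2 h⟩
      · exact ⟨k, hks, hfk, i, h⟩
    have hU : f '' {w | (∀ i, 0 ≤ w i) ∧ ∀ i ∉ s, w i = 0}
        = ⋃ j ∈ s, f '' {w | (∀ i, 0 ≤ w i) ∧ ∀ i ∉ s.erase j, w i = 0} := by
      ext y
      simp only [mem_iUnion]
      constructor
      · rintro ⟨w, ⟨hw1, hw2⟩, rfl⟩
        obtain ⟨i₀, hi₀⟩ := hkpos
        obtain ⟨j, hj, hjmin⟩ := Finset.exists_min_image (Finset.univ.filter fun i => 0 < k i)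
          (fun i => w i / k i) ⟨i₀, by simpa using hi₀⟩
        simp only [Finset.mem_filter, Finset.mem_univ, true_and] at hj hjmin
        have hjs : j ∈ s := by
          by_contra h
          exact hj.ne' (hks j h)
        refine ⟨j, hjs, w - (w j / k j) • k, ⟨fun i => ?_, fun i hi => ?_⟩, by simp [hfk]⟩
        · simp only [Pi.sub_apply, Pi.smul_apply, smul_eq_mul, sub_nonneg]
          rcases lt_or_ge 0 (k i) with h | h
          · exact (le_div_iff₀ h).1 (hjmin i h)
          · exact (mul_nonpos_of_nonneg_of_nonpos (div_nonneg (hw1 j) hj.le) h).trans (hw1 i)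
        · rw [Finset.mem_erase, not_and_or, not_not] at hi
          simp only [Pi.sub_apply, Pi.smul_apply, smul_eq_mul]
          rcases hi with rfl | hi
          · rw [div_mul_cancel₀ _ hj.ne', sub_self]
          · rw [hw2 i hi, hks i hi, mul_zero, sub_zero]
      · rintro ⟨j, hj, w, ⟨hw1, hw2⟩, rfl⟩
        exact ⟨w, ⟨hw1, fun i hi => hw2 i fun h => hi (Finset.mem_of_mem_erase h)⟩, rfl⟩
    rw [hU]
    exact isClosed_biUnion_finset fun j hj => ih _ (Finset.erase_ssubset hj)

/-- The linear image of a product of half-lines and lines is closed. -/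
theorem isClosed_image_nonneg_on (f : (ι → ℝ) →ₗ[ℝ] V) (J : Set ι) :
    IsClosed (f '' {w | ∀ i ∈ J, 0 ≤ w i}) := by
  classical
  let m : ((ι ⊕ ι) → ℝ) →ₗ[ℝ] (ι → ℝ) :=
    { toFun := fun w i => w (Sum.inl i) - if i ∈ J then 0 else w (Sum.inr i)
      map_add' := fun a b => by
        ext i; by_cases h : i ∈ J <;> simp [h]; ring
      map_smul' := fun c a => by
        ext i; by_cases h : i ∈ J <;> simp [h]; ring }
  convert isClosed_image_nonneg_supported (f ∘ₗ m) Finset.univ using 1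
  ext y
  constructor
  · rintro ⟨w, hw, rfl⟩
    refine ⟨Sum.elim (fun i => max (w i) 0) (fun i => max (-w i) 0), ⟨?_, by simp⟩, ?_⟩
    · rintro (i | i) <;> simp
    · rw [LinearMap.comp_apply]
      congr 1
      ext i
      by_cases h : i ∈ J
      · simp [m, h, hw i h]
      · simp [m, h, max_zero_sub_max_neg_zero_eq_self]
  · rintro ⟨w, ⟨hw, -⟩, rfl⟩
    refine ⟨m w, fun i hi => ?_, rfl⟩
    simp [m, hi, hw]

/-- Affine Farkas lemma: if a linear inequality `⟪ω, x⟫ ≤ h` holds on a nonempty polyhedron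
`{ω | A ω ≤ d}`, then it is implied by a nonnegative combination of the defining inequalities. -/
theorem exists_nonneg_combination {q n : ℕ} (A : Matrix (Fin q) (Fin n) ℝ) (d : Euc q)
    (hne : {ω : Euc n | ∀ k, (A *ᵥ ω.ofLp) k ≤ d k}.Nonempty) (x : Euc n) (h : ℝ)
    (hx : ∀ ω : Euc n, (∀ k, (A *ᵥ ω.ofLp) k ≤ d k) → inner ℝ ω x ≤ h) :
    ∃ σ ∈ nonnegOrthant q, Aᵀ *ᵥ σ.ofLp = x.ofLp ∧ inner ℝ d σ ≤ h := by
  -- the cone of the pairs `(Aᵀ σ, ⟪d, σ⟫ + s)` with `σ, s ≥ 0`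
  let f : (Option (Fin q) → ℝ) →ₗ[ℝ] (Euc n × ℝ) :=
    { toFun := fun w => (WithLp.toLp 2 (Aᵀ *ᵥ fun k => w (some k)),
        (d.ofLp ⬝ᵥ fun k => w (some k)) + w none)
      map_add' := fun a b => by
        have e : (fun k => (a + b) (some k)) = (fun k => a (some k)) + fun k => b (some k) := rfl
        rw [e, Matrix.mulVec_add, dotProduct_add]
        ext <;> simp
        ring
      map_smul' := fun c a => by
        have e : (fun k => (c • a) (some k)) = c • fun k => a (some k) := rfl
        rw [e, Matrix.mulVec_smul, dotProduct_smul]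
        ext <;> simp
        ring }
  have hcl := isClosed_image_nonneg_on f univ
  set C := f '' {w | ∀ i ∈ univ, 0 ≤ w i} with hC
  have hconv : Convex ℝ C := by
    refine Convex.linear_image ?_ f
    intro a ha b hb s t hs ht _ i _
    exact add_nonneg (mul_nonneg hs (ha i trivial)) (mul_nonneg ht (hb i trivial))
  by_contra hcon
  have hnot : (x, h) ∉ C := by
    rintro ⟨w, hw, hfw⟩
    refine hcon ⟨WithLp.toLp 2 fun k => w (some k), fun k => hw _ trivial,
      congrArg (fun p => p.1.ofLp) hfw, ?_⟩
    have h2 : (d.ofLp ⬝ᵥ fun k => w (some k)) + w none = h := congrArg Prod.snd hfw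
    rw [EuclideanSpace.inner_eq_star_dotProduct]
    simp only [star_trivial]
    rw [dotProduct_comm]
    linarith [hw none trivial]
  obtain ⟨g, c, hg, hc⟩ := geometric_hahn_banach_closed_point hconv hcl hnot
  have hc0 : 0 < c := by simpa using hg (f 0) ⟨0, fun _ _ => le_rfl, rfl⟩
  -- as `C` is a cone, the separating functional is nonpositive on it
  have hg0 : ∀ w : Option (Fin q) → ℝ, (∀ i, 0 ≤ w i) → g (f w) ≤ 0 := fun w hw => by
    by_contra! hpos
    have := hg (f ((c / g (f w)) • w))
      ⟨_, fun i _ => mul_nonneg (div_nonneg hc0.le hpos.le) (hw i), rfl⟩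
    rw [map_smul, map_smul, smul_eq_mul, div_mul_cancel₀ _ hpos.ne'] at this
    exact lt_irrefl _ this
  set w : Euc n := (InnerProductSpace.toDual ℝ (Euc n)).symm
    (g.comp (ContinuousLinearMap.inl ℝ (Euc n) ℝ))
  set τ : ℝ := g (0, 1)
  have hgw : ∀ u s, g (u, s) = inner ℝ w u + s * τ := fun u s => by
    have e : ((u, s) : Euc n × ℝ) = (u, 0) + s • (0, 1) := by simp
    rw [e, map_add, map_smul, smul_eq_mul]
    simp [w, τ]
  have hτ : τ ≤ 0 := by
    have := hg0 (Pi.single none 1) (fun i => by by_cases hi : i = none <;> simp [hi])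
    have e : f (Pi.single none 1) = (0, 1) := by
      have e0 : (fun k : Fin q => (Pi.single none 1 : Option (Fin q) → ℝ) (some k)) = 0 := by
        ext k; simp
      change (_, _) = _
      rw [e0]
      simp
    rwa [e] at this
  have hA : ∀ k, (A *ᵥ w.ofLp) k + d k * τ ≤ 0 := fun k => by
    have := hg0 (Pi.single (some k) 1) (fun i => by by_cases hi : i = some k <;> simp [hi])
    have e0 : (fun j : Fin q => (Pi.single (some k) 1 : Option (Fin q) → ℝ) (some j))
        = Pi.single k 1 := by
      ext j
      by_cases hj : j = k <;> simp [hj]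
    have e : f (Pi.single (some k) 1) = (WithLp.toLp 2 (A k), d k) := by
      change (_, _) = _
      rw [e0]
      simp [Matrix.col_transpose]
      rfl
    rw [e, hgw, EuclideanSpace.inner_eq_star_dotProduct] at this
    simpa [Matrix.mulVec] using this
  have hxw : 0 < inner ℝ w x + h * τ := by rw [← hgw]; exact hc0.trans hc
  rcases hτ.lt_or_eq with hlt | heq
  · -- the separating functional is, up to scaling, a point of the polyhedron violating `hx`
    have := hx ((-τ)⁻¹ • w) fun k => by
      rw [WithLp.ofLp_smul, Matrix.mulVec_smul, Pi.smul_apply, smul_eq_mul,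
        inv_mul_le_iff₀ (neg_pos.2 hlt)]
      linarith [hA k]
    rw [real_inner_smul_left, inv_mul_le_iff₀ (neg_pos.2 hlt)] at this
    linarith
  · -- the separating functional is a recession direction along which `hx` fails
    obtain ⟨ω, hω⟩ := hne
    rw [heq, mul_zero, add_zero] at hxw
    have hωx := hx ω hω
    have ht : 0 ≤ (h - inner ℝ ω x) / inner ℝ w x + 1 :=
      add_nonneg (div_nonneg (by linarith) hxw.le) zero_le_one
    have := hx (ω + ((h - inner ℝ ω x) / inner ℝ w x + 1) • w) fun k => by
      rw [WithLp.ofLp_add, WithLp.ofLp_smul, Matrix.mulVec_add, Matrix.mulVec_smul, Pi.add_apply,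
        Pi.smul_apply, smul_eq_mul]
      have hk := hA k
      rw [heq, mul_zero, add_zero] at hk
      linarith [hω k, mul_nonpos_of_nonneg_of_nonpos ht hk]
    rw [inner_add_left, real_inner_smul_left, add_mul, div_mul_cancel₀ _ hxw.ne'] at this
    linarith

end Cones

namespace GameData

variable {N n : ℕ} (G : GameData N n)

/-! ### The weighted Laplacian -/

/-- The Laplacian as a linear map. -/
noncomputable def lapₗ : Euc N →ₗ[ℝ] Euc N := Matrix.toEuclideanLin G.laplacian

theorem lap_apply (v : Euc N) (i : Fin N) : G.lap v i = ∑ j, G.adj i j * (v i - v j) := by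
  change (G.laplacian *ᵥ v.ofLp) i = _
  rw [laplacian, Matrix.sub_mulVec, Pi.sub_apply, Matrix.mulVec_diagonal]
  simp only [Matrix.mulVec, dotProduct, mul_sub, Finset.sum_sub_distrib, Finset.sum_mul]

variable {G}

theorem Standing.isSymmetric_lapₗ (hG : G.Standing) : G.lapₗ.IsSymmetric := by
  rw [lapₗ, Matrix.isSymmetric_toEuclideanLin_iff]
  ext i j
  by_cases h : i = j
  · simp [laplacian, h]
  · simp [laplacian, h, Ne.symm h, hG.adj_symm j i]

theorem Standing.inner_lap_left (hG : G.Standing) (v w : Euc N) :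
    inner ℝ (G.lap v) w = inner ℝ v (G.lap w) := hG.isSymmetric_lapₗ v w

theorem Standing.inner_lap_self (hG : G.Standing) (v : Euc N) :
    2 * inner ℝ (G.lap v) v = ∑ i, ∑ j, G.adj i j * (v i - v j) ^ 2 := by
  have h1 : inner ℝ (G.lap v) v = ∑ i, ∑ j, G.adj i j * (v i - v j) * v i := by
    simp only [PiLp.inner_apply, lap_apply, RCLike.inner_apply, conj_trivial, Finset.mul_sum]
    exact Finset.sum_congr rfl fun i _ => Finset.sum_congr rfl fun j _ => mul_comm _ _
  have h2 : ∑ i, ∑ j, G.adj i j * (v i - v j) * v i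
      = ∑ i, ∑ j, G.adj i j * (v j - v i) * v j := by
    rw [Finset.sum_comm]
    exact Finset.sum_congr rfl fun i _ => Finset.sum_congr rfl fun j _ => by
      rw [hG.adj_symm]
  have h3 : 2 * inner ℝ (G.lap v) v = (∑ i, ∑ j, G.adj i j * (v i - v j) * v i)
      + ∑ i, ∑ j, G.adj i j * (v j - v i) * v j := by rw [← h2, ← h1, two_mul]
  rw [h3, ← Finset.sum_add_distrib]
  refine Finset.sum_congr rfl fun i _ => ?_
  rw [← Finset.sum_add_distrib]
  exact Finset.sum_congr rfl fun j _ => by ring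

theorem Standing.adj_nonneg (hG : G.Standing) (i j : Fin N) : 0 ≤ G.adj i j := by
  by_cases h : G.graph.Adj i j
  · exact (hG.adj_pos i j h).le
  · exact (hG.adj_zero i j h).ge

theorem Standing.inner_lap_self_nonneg (hG : G.Standing) (v : Euc N) :
    0 ≤ inner ℝ (G.lap v) v := by
  have h := hG.inner_lap_self v
  have : 0 ≤ ∑ i, ∑ j, G.adj i j * (v i - v j) ^ 2 :=
    Finset.sum_nonneg fun i _ => Finset.sum_nonneg fun j _ =>
      mul_nonneg (hG.adj_nonneg i j) (sq_nonneg _)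
  linarith

/-- On a connected network the Laplacian quadratic form vanishes only at consensus. -/
theorem Standing.eq_of_inner_lap_self (hG : G.Standing) {v : Euc N}
    (h : inner ℝ (G.lap v) v ≤ 0) (i j : Fin N) : v i = v j := by
  have h0 := hG.inner_lap_self v
  have hnn : ∀ i j, 0 ≤ G.adj i j * (v i - v j) ^ 2 := fun i j =>
    mul_nonneg (hG.adj_nonneg i j) (sq_nonneg _)
  have hz : ∑ i, ∑ j, G.adj i j * (v i - v j) ^ 2 = 0 :=
    le_antisymm (by linarith) (Finset.sum_nonneg fun i _ => Finset.sum_nonneg fun j _ => hnn i j)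
  have hadj : ∀ i j, G.graph.Adj i j → v i = v j := fun i j hij => by
    have h1 := (Finset.sum_eq_zero_iff_of_nonneg fun i _ =>
      Finset.sum_nonneg fun j _ => hnn i j).1 hz i (Finset.mem_univ _)
    have h2 := (Finset.sum_eq_zero_iff_of_nonneg fun j _ => hnn i j).1 h1 j (Finset.mem_univ _)
    have h3 := (mul_eq_zero.1 h2).resolve_left (hG.adj_pos i j hij).ne'
    exact sub_eq_zero.1 (pow_eq_zero_iff two_ne_zero |>.1 h3)
  obtain ⟨w⟩ := hG.graph_connected.preconnected i j
  induction w with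
  | nil => rfl
  | cons hab _ ih => exact (hadj _ _ hab).trans ih

theorem lap_eq_zero_of_consensus {v : Euc N} (h : ∀ i j, v i = v j) : G.lap v = 0 := by
  ext i
  exact (G.lap_apply v i).trans (Finset.sum_eq_zero fun j _ => by rw [h i j, sub_self, mul_zero])

theorem Standing.sum_lap (hG : G.Standing) (v : Euc N) : ∑ i, G.lap v i = 0 := by
  have h1 : G.lap (WithLp.toLp 2 fun _ => (1 : ℝ)) = 0 := lap_eq_zero_of_consensus fun _ _ => rfl
  have h2 := hG.inner_lap_left v (WithLp.toLp 2 fun _ => (1 : ℝ))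
  rw [h1, inner_zero_right] at h2
  simpa [PiLp.inner_apply] using h2

/-- On a connected network the range of the Laplacian is the sum-zero hyperplane. -/
theorem Standing.exists_lap_eq (hG : G.Standing) {v : Euc N} (hv : ∑ i, v i = 0) :
    ∃ w, G.lap w = v := by
  have h : v ∈ (LinearMap.range G.lapₗ)ᗮᗮ := by
    rw [hG.isSymmetric_lapₗ.orthogonal_range, Submodule.mem_orthogonal]
    intro u hu
    have hu' : G.lap u = 0 := hu
    have hc := hG.eq_of_inner_lap_self (v := u) (by rw [hu', inner_zero_left])
    obtain ⟨i₀⟩ := hG.graph_connected.nonempty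
    simp only [PiLp.inner_apply, RCLike.inner_apply, conj_trivial, hc _ i₀, ← Finset.sum_mul, hv,
      zero_mul]
  rw [Submodule.orthogonal_orthogonal] at h
  exact h

variable (G)

/-! ### The extended game -/

/-- The total coupled load `z ↦ ∑ⱼ dⱼᵀ σⱼ` as a linear functional. -/
noncomputable def loadₗ : G.Z →ₗ[ℝ] ℝ where
  toFun z := ∑ i, G.B z i
  map_add' a b := by simp [B, inner_add_right, Finset.sum_add_distrib]
  map_smul' c a := by simp [B, inner_smul_right, Finset.mul_sum]

theorem loadₗ_apply (z : G.Z) : G.loadₗ z = ∑ i, G.B z i := rfl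

/-- `G.B` as a linear map. -/
noncomputable def Bₗ : G.Z →ₗ[ℝ] Euc N where
  toFun := G.B
  map_add' a b := by ext i; simp [B, inner_add_right]
  map_smul' c a := by ext i; simp [B, inner_smul_right]

/-- `G.BT` as a linear map. -/
noncomputable def BTₗ : Euc N →ₗ[ℝ] G.Z where
  toFun := G.BT
  map_add' a b := by
    ext i : 1
    refine WithLp.ofLp_injective 2 (Prod.ext ?_ ?_)
    · simp [BT]
    · simp [BT, add_smul]
  map_smul' c a := by
    ext i : 1
    refine WithLp.ofLp_injective 2 (Prod.ext ?_ ?_)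
    · simp [BT]
    · simp [BT, mul_smul]

/-- `G.xPart` as a linear map. -/
def xPartₗ : G.Z →ₗ[ℝ] Profile N n where
  toFun := G.xPart
  map_add' _ _ := rfl
  map_smul' _ _ := rfl

theorem xPart_sub (z w : G.Z) : G.xPart (z - w) = G.xPart z - G.xPart w := rfl

theorem lap_sub (v w : Euc N) : G.lap (v - w) = G.lap v - G.lap w := map_sub G.lapₗ v w

theorem inner_g (z w : G.Z) :
    inner ℝ (G.g z) w = inner ℝ (G.pseudoGrad (G.xPart z)) (G.xPart w) := by
  simp only [PiLp.inner_apply, WithLp.prod_inner_apply, g, pseudoGrad, xPart, inner_zero_left,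
    add_zero]
  rfl

theorem inner_BT (v : Euc N) (w : G.Z) : inner ℝ (G.BT v) w = inner ℝ v (G.B w) := by
  rw [PiLp.inner_apply, PiLp.inner_apply]
  refine Finset.sum_congr rfl fun i _ => ?_
  change inner ℝ (0 : Euc n) (w i).fst + inner ℝ (v i • G.d i) (w i).snd
    = inner ℝ (v i) (inner ℝ (G.d i) (w i).snd)
  rw [inner_zero_left, zero_add, real_inner_smul_left, RCLike.inner_apply, conj_trivial, mul_comm]

theorem norm_xPart_le (z : G.Z) : ‖G.xPart z‖ ≤ ‖z‖ := by
  refine le_of_sq_le_sq ?_ (norm_nonneg _)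
  rw [PiLp.norm_sq_eq_of_L2, PiLp.norm_sq_eq_of_L2]
  exact Finset.sum_le_sum fun i _ =>
    pow_le_pow_left₀ (norm_nonneg _) (WithLp.norm_fst_le _ (z i)) 2

theorem norm_g_sub_g (z w : G.Z) :
    ‖G.g z - G.g w‖ = ‖G.pseudoGrad (G.xPart z) - G.pseudoGrad (G.xPart w)‖ := by
  rw [← sq_eq_sq₀ (norm_nonneg _) (norm_nonneg _), PiLp.norm_sq_eq_of_L2, PiLp.norm_sq_eq_of_L2]
  refine Finset.sum_congr rfl fun i _ => ?_
  rw [WithLp.prod_norm_sq_eq_of_L2]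
  simp [g, pseudoGrad]

theorem mem_Omega_iff (z : G.Z) : z ∈ G.Omega ↔
    ∀ i, (z i).fst ∈ G.Θ i ∧ (z i).snd ∈ G.Sdual i ∧ (G.A i)ᵀ *ᵥ (z i).snd.ofLp = (z i).fst.ofLp := by
  refine forall_congr' fun i => ?_
  have : G.C i (z i) = 0 ↔ (G.A i)ᵀ *ᵥ (z i).snd.ofLp = (z i).fst.ofLp := by
    rw [C, WithLp.toLp_eq_zero, neg_add_eq_zero, eq_comm]
  rw [← this]
  exact and_assoc

theorem xPart_mem {z : G.Z} (hz : z ∈ G.Omega) : G.xPart z ∈ G.ThetaProd := fun i => (hz i).1.1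

/-- `J` is the set of the dual variables that carry a sign constraint, so that each `Sdual i` is a
product of half-lines and lines. -/
def SignConstraints (J : Set (Σ i, Fin (G.q i))) : Prop :=
  ∀ i σ, σ ∈ G.Sdual i ↔ ∀ k, (⟨i, k⟩ : Σ i, Fin (G.q i)) ∈ J → 0 ≤ σ k

theorem exists_signConstraints
    (hS : (∀ i, G.Sdual i = Set.univ) ∨ (∀ i, G.Sdual i = nonnegOrthant (G.q i))) :
    ∃ J, G.SignConstraints J := by
  rcases hS with hS | hS
  · exact ⟨∅, fun i σ => by simp [hS i]⟩
  · exact ⟨univ, fun i σ => by simp [hS i, nonnegOrthant]⟩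

variable {G}

theorem SignConstraints.isClosed_Sdual {J : Set (Σ i, Fin (G.q i))} (hJ : G.SignConstraints J)
    (i : Fin N) : IsClosed (G.Sdual i) := by
  have : G.Sdual i = {σ | ∀ k, (⟨i, k⟩ : Σ i, Fin (G.q i)) ∈ J → 0 ≤ σ k} := by
    ext σ; exact hJ i σ
  rw [this]
  simp only [ofPred_forall]
  exact isClosed_iInter fun k => isClosed_iInter fun _ =>
    isClosed_le continuous_const (by fun_prop)

theorem SignConstraints.convex_Sdual {J : Set (Σ i, Fin (G.q i))} (hJ : G.SignConstraints J)
    (i : Fin N) : Convex ℝ (G.Sdual i) := by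
  intro a ha b hb s t hs ht _
  rw [hJ] at ha hb ⊢
  exact fun k hk => add_nonneg (mul_nonneg hs (ha k hk)) (mul_nonneg ht (hb k hk))

theorem isClosed_Omega (hG : G.Standing) {J : Set (Σ i, Fin (G.q i))} (hJ : G.SignConstraints J) :
    IsClosed G.Omega := by
  have h1 : ∀ i, Continuous fun z : G.Z => (z i).fst := fun i =>
    (WithLp.fstL 2 ℝ _ _).continuous.comp (PiLp.proj 2 _ i (𝕜 := ℝ)).continuous
  have h2 : ∀ i, Continuous fun z : G.Z => (z i).snd := fun i =>
    (WithLp.sndL 2 ℝ _ _).continuous.comp (PiLp.proj 2 _ i (𝕜 := ℝ)).continuous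
  have : G.Omega = ⋂ i, ({z : G.Z | (z i).fst ∈ G.Θ i} ∩ ({z : G.Z | (z i).snd ∈ G.Sdual i} ∩
      {z : G.Z | (G.A i)ᵀ *ᵥ (z i).snd.ofLp = (z i).fst.ofLp})) := by
    ext z
    rw [mem_Omega_iff, mem_iInter]
    rfl
  rw [this]
  refine isClosed_iInter fun i => ((hG.Theta_compact i).isClosed.preimage (h1 i)).inter
    (((hJ.isClosed_Sdual i).preimage (h2 i)).inter (isClosed_eq ?_ ?_))
  · exact continuous_const.matrix_mulVec ((PiLp.continuous_ofLp 2 _).comp (h2 i))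
  · exact (PiLp.continuous_ofLp 2 _).comp (h1 i)

theorem convex_Omega (hG : G.Standing) {J : Set (Σ i, Fin (G.q i))} (hJ : G.SignConstraints J) :
    Convex ℝ G.Omega := by
  intro a ha b hb s t hs ht hst
  rw [mem_Omega_iff] at ha hb ⊢
  intro i
  obtain ⟨a1, a2, a3⟩ := ha i
  obtain ⟨b1, b2, b3⟩ := hb i
  refine ⟨hG.Theta_convex i a1 b1 hs ht hst, hJ.convex_Sdual i a2 b2 hs ht hst, ?_⟩
  have e : ((s • a + t • b) i).snd = s • (a i).snd + t • (b i).snd := rfl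
  have e' : ((s • a + t • b) i).fst = s • (a i).fst + t • (b i).fst := rfl
  rw [e, e', WithLp.ofLp_add, WithLp.ofLp_add, WithLp.ofLp_smul, WithLp.ofLp_smul,
    WithLp.ofLp_smul, WithLp.ofLp_smul, Matrix.mulVec_add, Matrix.mulVec_smul, Matrix.mulVec_smul,
    a3, b3]

theorem isCompact_ThetaProd (hG : G.Standing) : IsCompact G.ThetaProd := by
  have h := (isCompact_univ_pi hG.Theta_compact).image
    (PiLp.continuousLinearEquiv 2 ℝ fun _ : Fin N => Euc n).symm.continuous
  convert h using 1
  ext x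
  constructor
  · exact fun hx => ⟨x.ofLp, fun i _ => hx i, rfl⟩
  · rintro ⟨y, hy, rfl⟩
    exact fun i => hy i trivial

theorem Standing.inner_pseudoGrad_nonneg (hG : G.Standing) {x y : Profile N n}
    (hx : x ∈ G.ThetaProd) (hy : y ∈ G.ThetaProd) :
    0 ≤ inner ℝ (G.pseudoGrad x - G.pseudoGrad y) (x - y) := by
  by_cases h : x = y
  · simp [h]
  · exact (hG.F_strictMono x hx y hy h).le

theorem Standing.eq_of_inner_pseudoGrad (hG : G.Standing) {x y : Profile N n}
    (hx : x ∈ G.ThetaProd) (hy : y ∈ G.ThetaProd)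
    (h : inner ℝ (G.pseudoGrad x - G.pseudoGrad y) (x - y) ≤ 0) : x = y := by
  by_contra hne
  exact absurd (hG.F_strictMono x hx y hy hne) (not_lt.2 h)

/-! ### Primal-dual solutions -/

/-- `z` solves the variational inequality of `g` on `Ξ` with the scalar multiplier `μ` for the
coupled constraint. -/
structure IsKKT (G : GameData N n) (z : G.Z) (μ : ℝ) : Prop where
  mem : z ∈ G.Omega
  nonneg : 0 ≤ μ
  feasible : G.loadₗ z ≤ G.b
  complementary : μ * (G.loadₗ z - G.b) = 0
  stationary : ∀ y ∈ G.Omega, 0 ≤ inner ℝ (G.g z) (y - z) + μ * (G.loadₗ y - G.loadₗ z)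

/-- The action profiles that satisfy the coupled constraint form a compact set. Closedness rests on
the closedness of finitely generated cones, as the dual variables are unbounded. -/
theorem isCompact_feasible_profiles (hG : G.Standing) {J : Set (Σ i, Fin (G.q i))}
    (hJ : G.SignConstraints J) : IsCompact {x | ∃ z ∈ G.Omega, G.xPart z = x ∧ G.loadₗ z ≤ G.b} := by
  -- `none` indexes the slack of the coupled constraint
  let f : (Option (Σ i, Fin (G.q i)) → ℝ) →ₗ[ℝ] (Profile N n × ℝ) :=
    { toFun := fun w => (WithLp.toLp 2 fun i => WithLp.toLp 2 ((G.A i)ᵀ *ᵥ fun k => w (some ⟨i, k⟩)),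
        (∑ i, (G.d i).ofLp ⬝ᵥ fun k => w (some ⟨i, k⟩)) + w none)
      map_add' := fun a b => by
        refine Prod.ext ?_ ?_
        · ext i : 1
          exact congrArg (WithLp.toLp 2) (Matrix.mulVec_add _ _ _)
        · change (∑ i, (G.d i).ofLp ⬝ᵥ ((fun k => a (some ⟨i, k⟩)) + fun k => b (some ⟨i, k⟩)))
            + (a none + b none) = (_ + a none) + (_ + b none)
          simp only [dotProduct_add, Finset.sum_add_distrib]
          ring
      map_smul' := fun c a => by
        refine Prod.ext ?_ ?_
        · ext i : 1
          exact congrArg (WithLp.toLp 2) (Matrix.mulVec_smul _ _ _)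
        · change (∑ i, (G.d i).ofLp ⬝ᵥ (c • fun k => a (some ⟨i, k⟩))) + c * a none
            = c * (_ + a none)
          simp only [dotProduct_smul, smul_eq_mul, mul_add, Finset.mul_sum] }
  have hcl := isClosed_image_nonneg_on f (insert none (some '' J))
  have hdot : ∀ i (σ : Euc (G.q i)), inner ℝ (G.d i) σ = (G.d i).ofLp ⬝ᵥ σ.ofLp := fun i σ => by
    rw [EuclideanSpace.inner_eq_star_dotProduct, star_trivial, dotProduct_comm]
  have hK : {x | ∃ z ∈ G.Omega, G.xPart z = x ∧ G.loadₗ z ≤ G.b} = G.ThetaProd ∩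
      (fun x => (x, G.b)) ⁻¹' (f '' {w | ∀ i ∈ insert none (some '' J), 0 ≤ w i}) := by
    ext x
    constructor
    · rintro ⟨z, hz, rfl, hb⟩
      refine ⟨G.xPart_mem hz, fun o => o.elim (G.b - G.loadₗ z) fun p => (z p.1).snd p.2, ?_, ?_⟩
      · rintro _ (rfl | ⟨p, hp, rfl⟩)
        · exact sub_nonneg.2 hb
        · exact (hJ _ _).1 (hz p.1).1.2 p.2 hp
      · refine Prod.ext ?_ ?_
        · ext i : 1
          exact congrArg (WithLp.toLp 2) (((G.mem_Omega_iff z).1 hz) i).2.2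
        · change (∑ i, (G.d i).ofLp ⬝ᵥ (z i).snd.ofLp) + (G.b - G.loadₗ z) = G.b
          have : G.loadₗ z = ∑ i, (G.d i).ofLp ⬝ᵥ (z i).snd.ofLp := by
            rw [loadₗ_apply]
            exact Finset.sum_congr rfl fun i _ => hdot i _
          rw [this]; ring
    · rintro ⟨hx, w, hw, hfw⟩
      have h1 : ∀ i, (G.A i)ᵀ *ᵥ (fun k => w (some ⟨i, k⟩)) = (x i).ofLp := fun i =>
        congrArg (fun p : Profile N n × ℝ => (p.1 i).ofLp) hfw
      have h2 : (∑ i, (G.d i).ofLp ⬝ᵥ fun k => w (some ⟨i, k⟩)) + w none = G.b :=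
        congrArg Prod.snd hfw
      refine ⟨WithLp.toLp 2 fun i => WithLp.toLp 2 (x i, WithLp.toLp 2 fun k => w (some ⟨i, k⟩)),
        (G.mem_Omega_iff _).2 fun i => ⟨hx i, (hJ _ _).2 fun k hk => ?_, h1 i⟩, rfl, ?_⟩
      · exact hw _ (mem_insert_of_mem _ ⟨_, hk, rfl⟩)
      · have h3 := hw none (mem_insert _ _)
        rw [loadₗ_apply]
        simp only [B, hdot]
        change (∑ i, (G.d i).ofLp ⬝ᵥ fun k => w (some ⟨i, k⟩)) ≤ G.b
        linarith
  rw [hK]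
  exact (isCompact_ThetaProd hG).inter_right (hcl.preimage (by fun_prop))

/-- The robust Slater point lifts to the extended game: by the affine Farkas lemma the worst-case
load over the inscribed polyhedron is realized by nonnegative dual variables. -/
theorem exists_slater (hG : G.Standing) (hP : G.Inscribed) {J : Set (Σ i, Fin (G.q i))}
    (hJ : G.SignConstraints J) : ∃ z ∈ G.Omega, G.loadₗ z < G.b := by
  obtain ⟨x, hx, hsl⟩ := hG.slater
  have hxΘ : x ∈ G.ThetaProd := intrinsicInterior_subset hx
  have hmax : ∀ i, ∃ ω ∈ G.M i, ∀ ω' ∈ G.M i, inner ℝ ω' (x i) ≤ inner ℝ ω (x i) := fun i =>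
    (hG.M_compact i).exists_isMaxOn ((hP.nonempty i).mono (hP.subset i))
      (f := fun ω => inner ℝ ω (x i)) (by fun_prop)
  choose ω hωM hω using hmax
  have hσ : ∀ i, ∃ σ ∈ nonnegOrthant (G.q i), (G.A i)ᵀ *ᵥ σ.ofLp = (x i).ofLp ∧
      inner ℝ (G.d i) σ ≤ inner ℝ (ω i) (x i) := fun i =>
    exists_nonneg_combination (G.A i) (G.d i) (hP.nonempty i) (x i) _
      fun ω' hω' => hω i ω' (hP.subset i hω')
  choose σ hσ0 hσA hσd using hσ
  refine ⟨WithLp.toLp 2 fun i => WithLp.toLp 2 (x i, σ i),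
    (G.mem_Omega_iff _).2 fun i => ⟨hxΘ i, (hJ _ _).2 fun k _ => hσ0 i k, hσA i⟩, ?_⟩
  exact (Finset.sum_le_sum fun i _ => hσd i).trans_lt (hsl ω hωM)

theorem exists_isKKT (hG : G.Standing) (hP : G.Inscribed)
    (hF : LocallyLipschitzOn G.ThetaProd G.pseudoGrad) {J : Set (Σ i, Fin (G.q i))}
    (hJ : G.SignConstraints J) : ∃ z μ, G.IsKKT z μ := by
  obtain ⟨K, hK⟩ := hF.exists_lipschitzOnWith_of_compact (isCompact_ThetaProd hG)
  obtain ⟨z₀, hz₀, hz₀b⟩ := exists_slater hG hP hJ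
  set X := {x | ∃ z ∈ G.Omega, G.xPart z = x ∧ G.loadₗ z ≤ G.b}
  have hXΘ : X ⊆ G.ThetaProd := by
    rintro _ ⟨z, hz, rfl, -⟩
    exact G.xPart_mem hz
  have hXconv : Convex ℝ X := by
    rintro _ ⟨a, ha, rfl, hab⟩ _ ⟨b, hb, rfl, hbb⟩ s t hs ht hst
    refine ⟨s • a + t • b, convex_Omega hG hJ ha hb hs ht hst, rfl, ?_⟩
    have e : s * G.b + t * G.b = G.b := by rw [← add_mul, hst, one_mul]
    rw [map_add, map_smul, map_smul, smul_eq_mul, smul_eq_mul]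
    linarith [mul_le_mul_of_nonneg_left hab hs, mul_le_mul_of_nonneg_left hbb ht]
  obtain ⟨_, ⟨z, hz, rfl, hzb⟩, hvi⟩ := exists_vi_of_monotone
    (isCompact_feasible_profiles hG hJ) hXconv ⟨_, z₀, hz₀, rfl, hz₀b.le⟩ (hK.mono hXΘ)
    (fun u hu v hv => hG.inner_pseudoGrad_nonneg (hXΘ hu) (hXΘ hv))
  obtain ⟨μ, hμ, hmul⟩ := exists_multiplier_of_slater (convex_Omega hG hJ)
    (innerₛₗ ℝ (G.pseudoGrad (G.xPart z)) ∘ₗ G.xPartₗ) G.loadₗ hz₀ hz₀b (zs := z)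
    fun y hy hyb => by
      have := hvi _ ⟨y, hy, rfl, hyb⟩
      rw [inner_sub_right] at this
      exact sub_nonneg.1 this
  have hcomp : μ * (G.loadₗ z - G.b) = 0 := by
    have h1 := hmul z hz
    rw [sub_self, zero_add] at h1
    exact le_antisymm (mul_nonpos_of_nonneg_of_nonpos hμ (sub_nonpos.2 hzb)) h1
  refine ⟨z, μ, hz, hμ, hzb, hcomp, fun y hy => ?_⟩
  have h1 : 0 ≤ inner ℝ (G.pseudoGrad (G.xPart z)) (G.xPart y)
      - inner ℝ (G.pseudoGrad (G.xPart z)) (G.xPart z) + μ * (G.loadₗ y - G.b) := hmul y hy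
  rw [inner_g, xPart_sub, inner_sub_right]
  linarith

/-- If the load of a primal-dual solution can be made slack without changing the action profile,
then the slack point is a primal-dual solution with multiplier zero. -/
theorem IsKKT.of_slack {z z₀ : G.Z} {μ : ℝ} (h : G.IsKKT z μ) (hz₀ : z₀ ∈ G.Omega)
    (hx : G.xPart z₀ = G.xPart z) (hb : G.loadₗ z₀ < G.b) : G.IsKKT z₀ 0 := by
  have hμ : μ = 0 := by
    have h1 := h.stationary z₀ hz₀
    rw [inner_g, xPart_sub, hx, sub_self, inner_zero_right, zero_add] at h1
    have h2 := h.complementary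
    by_contra hne
    have h3 : 0 < μ := lt_of_le_of_ne h.nonneg (Ne.symm hne)
    nlinarith
  refine ⟨hz₀, le_rfl, hb.le, zero_mul _, fun y hy => ?_⟩
  have h1 := h.stationary y hy
  rw [hμ, zero_mul, add_zero, inner_g, xPart_sub] at h1
  rwa [zero_mul, add_zero, inner_g, xPart_sub, hx]

variable (G)

/-! ### The dynamics as a projected monotone flow -/

/-- The joint state `(z, λ, ζ)` with its Euclidean norm. -/
abbrev State : Type := WithLp 2 (G.Z × WithLp 2 (Euc N × Euc N))

/-- The state with the given components. -/
def mkState (z : G.Z) (lam zeta : Euc N) : G.State := WithLp.toLp 2 (z, WithLp.toLp 2 (lam, zeta))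

/-- The set `Ω × ℝ₊ᴺ × ℝᴺ` of admissible states. -/
def stateSet : Set G.State := {u | u.fst ∈ G.Omega ∧ u.snd.fst ∈ nonnegOrthant N}

/-- The projection onto `G.stateSet`. -/
noncomputable def stateProj (u : G.State) : G.State :=
  G.mkState (projOnto G.Omega u.fst) (projOnto (nonnegOrthant N) u.snd.fst) u.snd.snd

/-- The primal-dual operator of the augmented Lagrangian. Its skew couplings of `z` with `λ` and of
`λ` with `ζ` do not contribute to monotonicity. -/
noncomputable def stateOp (u : G.State) : G.State :=
  G.mkState (G.g u.fst + G.BT u.snd.fst)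
    (-G.B u.fst + G.bloc + G.lap u.snd.fst + G.lap u.snd.snd) (-G.lap u.snd.fst)

theorem projField_state (u : G.State) : projField G.stateProj G.stateOp u =
    G.mkState (G.rhsZ u.fst u.snd.fst) (G.rhsLam u.fst u.snd.fst u.snd.snd) (G.lap u.snd.fst) := by
  have h1 : u.fst - (G.g u.fst + G.BT u.snd.fst) = u.fst - G.g u.fst - G.BT u.snd.fst := by abel
  have h2 : u.snd.fst - (-G.B u.fst + G.bloc + G.lap u.snd.fst + G.lap u.snd.snd)
      = u.snd.fst + G.B u.fst - G.bloc - G.lap u.snd.fst - G.lap u.snd.snd := by abel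
  have h3 : u.snd.snd - (-G.lap u.snd.fst) - u.snd.snd = G.lap u.snd.fst := by abel
  change G.mkState (projOnto G.Omega (u.fst - (G.g u.fst + G.BT u.snd.fst)) - u.fst)
    (projOnto (nonnegOrthant N)
      (u.snd.fst - (-G.B u.fst + G.bloc + G.lap u.snd.fst + G.lap u.snd.snd)) - u.snd.fst)
    (u.snd.snd - (-G.lap u.snd.fst) - u.snd.snd) = _
  rw [h1, h2, h3]
  rfl

theorem isClosed_nonnegOrthant (m : ℕ) : IsClosed (nonnegOrthant m) := by
  simp only [nonnegOrthant, ofPred_forall]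
  exact isClosed_iInter fun k => isClosed_le continuous_const (by fun_prop)

theorem convex_nonnegOrthant (m : ℕ) : Convex ℝ (nonnegOrthant m) :=
  fun _ ha _ hb _ _ hs ht _ k => add_nonneg (mul_nonneg hs (ha k)) (mul_nonneg ht (hb k))

theorem isProjectionOn_nonnegOrthant (m : ℕ) :
    IsProjectionOn (projOnto (nonnegOrthant m)) (nonnegOrthant m) :=
  isProjectionOn_projOnto ⟨0, fun _ => le_rfl⟩ (isClosed_nonnegOrthant m) (convex_nonnegOrthant m)

theorem le_projOnto_nonnegOrthant {m : ℕ} (v : Euc m) (k : Fin m) :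
    v k ≤ projOnto (nonnegOrthant m) v k := by
  have hP := isProjectionOn_nonnegOrthant m
  have h := hP.inner_le v (projOnto (nonnegOrthant m) v + EuclideanSpace.single k 1) fun j =>
    add_nonneg (hP.mem v j) (by by_cases hj : j = k <;> simp [hj])
  simpa [EuclideanSpace.inner_single_right] using h

variable {G}

theorem isProjectionOn_stateProj (hG : G.Standing) {J : Set (Σ i, Fin (G.q i))}
    (hJ : G.SignConstraints J) (hne : G.Omega.Nonempty) :
    IsProjectionOn G.stateProj G.stateSet := by
  have h1 := isProjectionOn_projOnto hne (isClosed_Omega hG hJ) (convex_Omega hG hJ)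
  have h2 := isProjectionOn_nonnegOrthant N
  refine ⟨fun v => ⟨h1.mem _, h2.mem _⟩, fun v y hy => ?_⟩
  have e : inner ℝ (v - G.stateProj v) (y - G.stateProj v)
      = inner ℝ (v.fst - projOnto G.Omega v.fst) (y.fst - projOnto G.Omega v.fst)
      + (inner ℝ (v.snd.fst - projOnto (nonnegOrthant N) v.snd.fst)
          (y.snd.fst - projOnto (nonnegOrthant N) v.snd.fst)
        + inner ℝ (v.snd.snd - v.snd.snd) (y.snd.snd - v.snd.snd)) := rfl
  rw [e, sub_self v.snd.snd, inner_zero_left, add_zero]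
  exact add_nonpos (h1.inner_le _ _ hy.1) (h2.inner_le _ _ hy.2)

theorem isClosed_stateSet (hG : G.Standing) {J : Set (Σ i, Fin (G.q i))}
    (hJ : G.SignConstraints J) : IsClosed G.stateSet := by
  have h1 : Continuous fun u : G.State => u.fst := (WithLp.fstL 2 ℝ _ _).continuous
  have h2 : Continuous fun u : G.State => u.snd.fst :=
    (WithLp.fstL 2 ℝ _ _).continuous.comp (WithLp.sndL 2 ℝ _ _).continuous
  exact ((isClosed_Omega hG hJ).preimage h1).inter ((isClosed_nonnegOrthant N).preimage h2)

theorem exists_lipschitzOnWith_stateOp (hG : G.Standing)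
    (hF : LocallyLipschitzOn G.ThetaProd G.pseudoGrad) :
    ∃ K, LipschitzOnWith K G.stateOp G.stateSet := by
  obtain ⟨K, hK⟩ := hF.exists_lipschitzOnWith_of_compact (isCompact_ThetaProd hG)
  -- the affine part is Lipschitz as a linear map in finite dimension plus a constant
  let L : G.State →ₗ[ℝ] G.State :=
    { toFun := fun u => G.mkState (G.BTₗ u.snd.fst)
        (-G.Bₗ u.fst + G.lapₗ u.snd.fst + G.lapₗ u.snd.snd) (-G.lapₗ u.snd.fst)
      map_add' := fun u v => by
        change G.mkState (G.BTₗ (u.snd.fst + v.snd.fst)) (-G.Bₗ (u.fst + v.fst)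
            + G.lapₗ (u.snd.fst + v.snd.fst) + G.lapₗ (u.snd.snd + v.snd.snd))
            (-G.lapₗ (u.snd.fst + v.snd.fst))
          = G.mkState (G.BTₗ u.snd.fst + G.BTₗ v.snd.fst)
            (-G.Bₗ u.fst + G.lapₗ u.snd.fst + G.lapₗ u.snd.snd
              + (-G.Bₗ v.fst + G.lapₗ v.snd.fst + G.lapₗ v.snd.snd))
            (-G.lapₗ u.snd.fst + -G.lapₗ v.snd.fst)
        simp only [map_add]
        congr 1 <;> abel
      map_smul' := fun c u => by
        change G.mkState (G.BTₗ (c • u.snd.fst)) (-G.Bₗ (c • u.fst) + G.lapₗ (c • u.snd.fst)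
            + G.lapₗ (c • u.snd.snd)) (-G.lapₗ (c • u.snd.fst))
          = G.mkState (c • G.BTₗ u.snd.fst)
            (c • (-G.Bₗ u.fst + G.lapₗ u.snd.fst + G.lapₗ u.snd.snd)) (c • -G.lapₗ u.snd.fst)
        simp only [map_smul, smul_add, smul_neg] }
  have hL := (LinearMap.toContinuousLinearMap L).lipschitz.lipschitzOnWith (s := G.stateSet)
  have h0 : LipschitzOnWith K (fun u : G.State => G.mkState (G.g u.fst) G.bloc 0) G.stateSet := by
    refine LipschitzOnWith.of_dist_le_mul fun u hu v hv => ?_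
    rw [dist_eq_norm, dist_eq_norm]
    have e : G.mkState (G.g u.fst) G.bloc 0 - G.mkState (G.g v.fst) G.bloc 0
        = WithLp.toLp 2 (G.g u.fst - G.g v.fst, (0 : WithLp 2 (Euc N × Euc N))) := by
      change G.mkState (G.g u.fst - G.g v.fst) (G.bloc - G.bloc) (0 - 0) = _
      rw [sub_self, sub_self]
      rfl
    rw [e, WithLp.norm_toLp_fst, norm_g_sub_g]
    refine (hK.norm_sub_le (G.xPart_mem hu.1) (G.xPart_mem hv.1)).trans ?_
    rw [← xPart_sub]
    gcongr
    exact (G.norm_xPart_le _).trans (WithLp.norm_fst_le _ (u - v))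
  have e : G.stateOp =
      fun u => G.mkState (G.g u.fst) G.bloc 0 + LinearMap.toContinuousLinearMap L u := by
    ext1 u
    symm
    change G.mkState (G.g u.fst + G.BT u.snd.fst)
      (G.bloc + (-G.B u.fst + G.lap u.snd.fst + G.lap u.snd.snd)) (0 + -G.lap u.snd.fst) = _
    rw [zero_add, stateOp]
    congr 1
    abel
  rw [e]
  exact ⟨_, h0.add hL⟩

theorem inner_stateOp (u w : G.State) : inner ℝ (G.stateOp u) w =
    inner ℝ (G.g u.fst + G.BT u.snd.fst) w.fst
      + (inner ℝ (-G.B u.fst + G.bloc + G.lap u.snd.fst + G.lap u.snd.snd) w.snd.fst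
        + inner ℝ (-G.lap u.snd.fst) w.snd.snd) := rfl

/-- The skew couplings cancel in the monotonicity form of the primal-dual operator. -/
theorem inner_stateOp_sub (hG : G.Standing) (u v : G.State) :
    inner ℝ (G.stateOp u - G.stateOp v) (u - v) =
      inner ℝ (G.pseudoGrad (G.xPart u.fst) - G.pseudoGrad (G.xPart v.fst))
        (G.xPart u.fst - G.xPart v.fst)
      + inner ℝ (G.lap (u.snd.fst - v.snd.fst)) (u.snd.fst - v.snd.fst) := by
  have hL : ∀ a b, inner ℝ (G.lap a) b = inner ℝ (G.lap b) a := fun a b => by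
    rw [hG.inner_lap_left, real_inner_comm]
  rw [inner_sub_left, inner_stateOp, inner_stateOp]
  simp only [WithLp.sub_fst, WithLp.sub_snd, inner_add_left, inner_neg_left, inner_sub_right,
    inner_sub_left, inner_g, inner_BT, lap_sub,
    real_inner_comm (G.B u.fst), real_inner_comm (G.B v.fst)]
  rw [hL u.snd.snd u.snd.fst, hL u.snd.snd v.snd.fst, hL v.snd.snd u.snd.fst,
    hL v.snd.snd v.snd.fst]
  simp only [real_inner_comm _ (G.B u.fst), real_inner_comm _ (G.B v.fst)]
  ring

theorem stateOp_monotone (hG : G.Standing) {u v : G.State} (hu : u ∈ G.stateSet)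
    (hv : v ∈ G.stateSet) : 0 ≤ inner ℝ (G.stateOp u - G.stateOp v) (u - v) := by
  rw [inner_stateOp_sub hG]
  exact add_nonneg (hG.inner_pseudoGrad_nonneg (G.xPart_mem hu.1) (G.xPart_mem hv.1))
    (hG.inner_lap_self_nonneg _)

theorem sum_B_sub_bloc (z : G.Z) : ∑ i, (G.B z - G.bloc) i = G.loadₗ z - G.b := by
  simp [loadₗ_apply, b, Finset.sum_sub_distrib]

/-- A primal-dual solution extends to a solution of the variational inequality of the primal-dual
operator: `λ` is the consensual multiplier and `ζ` equalizes the local constraint residuals. The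
last conjunct splits the inequality into its `z`-part and its `λ`-part. -/
theorem IsKKT.exists_state (hG : G.Standing) {z : G.Z} {μ : ℝ} (h : G.IsKKT z μ) :
    ∃ p ∈ G.stateSet, p.fst = z ∧ (∀ i j, p.snd.fst i = p.snd.fst j) ∧
      (∀ y ∈ G.stateSet, 0 ≤ inner ℝ (G.stateOp p) (y - p)) ∧
      ∀ y : G.State, inner ℝ (G.stateOp p) (y - p) =
        (inner ℝ (G.g z) (y.fst - z) + μ * (G.loadₗ y.fst - G.loadₗ z))
          + (G.b - G.loadₗ z) / N * ∑ i, y.snd.fst i := by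
  obtain ⟨i₀⟩ := hG.graph_connected.nonempty
  have hN : (N : ℝ) ≠ 0 := by
    have : 0 < N := i₀.pos
    positivity
  set m : ℝ := (G.b - G.loadₗ z) / N with hm
  have hNm : N * m = G.b - G.loadₗ z := mul_div_cancel₀ _ hN
  set one : Euc N := WithLp.toLp 2 fun _ => (1 : ℝ) with hone
  have hsum : ∀ v : Euc N, inner ℝ one v = ∑ i, v i := fun v => by
    simp [PiLp.inner_apply, hone]
  obtain ⟨ζ, hζ⟩ := hG.exists_lap_eq (v := G.B z - G.bloc + m • one) (by
    rw [← hsum, inner_add_right, hsum, sum_B_sub_bloc, inner_smul_right, hsum]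
    simp only [hone, Finset.sum_const, Finset.card_univ, Fintype.card_fin, nsmul_eq_mul, mul_one]
    linarith)
  have hlap : G.lap (μ • one) = 0 := lap_eq_zero_of_consensus fun _ _ => rfl
  have hform : ∀ y : G.State, inner ℝ (G.stateOp (G.mkState z (μ • one) ζ))
      (y - G.mkState z (μ • one) ζ) =
        (inner ℝ (G.g z) (y.fst - z) + μ * (G.loadₗ y.fst - G.loadₗ z))
          + m * ∑ i, y.snd.fst i := fun y => by
    rw [inner_stateOp]
    change inner ℝ (G.g z + G.BT (μ • one)) (y.fst - z)
      + (inner ℝ (-G.B z + G.bloc + G.lap (μ • one) + G.lap ζ) (y.snd.fst - μ • one)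
        + inner ℝ (-G.lap (μ • one)) (y.snd.snd - ζ)) = _
    have e : -G.B z + G.bloc + G.lap (μ • one) + G.lap ζ = m • one := by
      rw [hlap, hζ]; abel
    rw [e, hlap, neg_zero, inner_zero_left, add_zero, inner_add_left, inner_BT,
      real_inner_smul_left, real_inner_smul_left, hsum, hsum, ← loadₗ_apply, map_sub]
    have e2 : ∑ i, one i = N := by simp [hone]
    have e3 : μ * (N * m) = 0 := by
      rw [hNm]; linarith [h.complementary]
    have e4 : ∑ i, (y.snd.fst - μ • one) i = ∑ i, y.snd.fst i - μ * N := by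
      rw [← hsum, inner_sub_right, hsum, inner_smul_right, hsum, e2]
    rw [e4]
    linarith
  refine ⟨G.mkState z (μ • one) ζ, ⟨h.mem, fun i => mul_nonneg h.nonneg zero_le_one⟩, rfl,
    fun _ _ => rfl, fun y hy => ?_, hform⟩
  rw [hform]
  refine add_nonneg (h.stationary _ hy.1) (mul_nonneg ?_ (Finset.sum_nonneg fun i _ => hy.2 i))
  exact div_nonneg (sub_nonneg.2 h.feasible) (Nat.cast_nonneg N)

/-- A trajectory stays in the set of admissible states, and solves the projected flow there. -/
theorem IsTrajectory.isProjSolution (hG : G.Standing) {J : Set (Σ i, Fin (G.q i))}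
    (hJ : G.SignConstraints J) {z : ℝ → G.Z} {lam zeta : ℝ → Euc N}
    (h : G.IsTrajectory z lam zeta) :
    IsProjSolution G.stateProj G.stateOp G.stateSet
      fun t => G.mkState (z t) (lam t) (zeta t) := by
  have hP := isProjectionOn_projOnto ⟨_, h.z_init⟩ (isClosed_Omega hG hJ) (convex_Omega hG hJ)
  refine ⟨fun t ht => ⟨?_, ?_⟩, fun t ht => ?_⟩
  · exact mem_of_hasDerivWithinAt_sub (isClosed_Omega hG hJ) (convex_Omega hG hJ) h.z_init
      (fun t _ => hP.mem _) h.z_deriv ht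
  · exact mem_of_hasDerivWithinAt_sub (isClosed_nonnegOrthant N) (convex_nonnegOrthant N)
      h.lam_init (fun t _ => (isProjectionOn_nonnegOrthant N).mem _) h.lam_deriv ht
  · rw [projField_state]
    have h1 := (WithLp.prodContinuousLinearEquiv 2 ℝ (Euc N)
      (Euc N)).symm.toContinuousLinearMap.hasFDerivAt.comp_hasDerivWithinAt t
      ((h.lam_deriv t ht).prodMk (h.zeta_deriv t ht))
    exact (WithLp.prodContinuousLinearEquiv 2 ℝ G.Z
      (WithLp 2 (Euc N × Euc N))).symm.toContinuousLinearMap.hasFDerivAt.comp_hasDerivWithinAt t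
      ((h.z_deriv t ht).prodMk h1)

/-- An equilibrium state satisfies the first order conditions. -/
theorem firstOrder_of_vi (hG : G.Standing) {p : G.State} (hp : p ∈ G.stateSet)
    (hvi : ∀ y ∈ G.stateSet, 0 ≤ inner ℝ (G.stateOp p) (y - p)) (hlap : G.lap p.snd.fst = 0) :
    G.FirstOrder p.fst p.snd.fst := by
  have hz : ∀ y ∈ G.Omega, 0 ≤ inner ℝ (G.g p.fst + G.BT p.snd.fst) (y - p.fst) := fun y hy => by
    have := hvi (G.mkState y p.snd.fst p.snd.snd) ⟨hy, hp.2⟩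
    rw [inner_stateOp] at this
    change 0 ≤ inner ℝ _ (y - p.fst) + (inner ℝ _ (p.snd.fst - p.snd.fst)
      + inner ℝ _ (p.snd.snd - p.snd.snd)) at this
    rwa [sub_self, sub_self, inner_zero_right, inner_zero_right, add_zero, add_zero] at this
  have hl : ∀ l ∈ nonnegOrthant N,
      0 ≤ inner ℝ (-(G.B p.fst - G.bloc) + G.lap p.snd.snd) (l - p.snd.fst) := fun l hl => by
    have := hvi (G.mkState p.fst l p.snd.snd) ⟨hp.1, hl⟩
    rw [inner_stateOp, hlap] at this
    change 0 ≤ inner ℝ _ (p.fst - p.fst) + (inner ℝ _ (l - p.snd.fst)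
      + inner ℝ _ (p.snd.snd - p.snd.snd)) at this
    rw [sub_self, sub_self, inner_zero_right, inner_zero_right, add_zero, zero_add, add_zero] at this
    rwa [neg_sub, sub_eq_neg_add]
  refine ⟨hp.2, hp.1, fun y hy => ?_, ?_, ?_, hlap⟩
  · rw [inner_neg_left]
    exact neg_nonpos.2 (hz y hy)
  · -- test with `λ + 1`
    have h1 := hl (p.snd.fst + WithLp.toLp 2 fun _ => (1 : ℝ))
      fun i => add_nonneg (hp.2 i) zero_le_one
    have h2 := hG.sum_lap p.snd.snd
    have e : inner ℝ (-(G.B p.fst - G.bloc) + G.lap p.snd.snd)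
        (p.snd.fst + (WithLp.toLp 2 fun _ => (1 : ℝ)) - p.snd.fst)
        = -∑ i, (G.B p.fst - G.bloc) i + ∑ i, G.lap p.snd.snd i := by
      rw [add_sub_cancel_left, inner_add_left, inner_neg_left]
      simp [PiLp.inner_apply]
    rw [e, h2] at h1
    linarith
  · -- test with `0` and `2 λ`
    have h1 := hl 0 fun _ => le_rfl
    have h2 := hl (p.snd.fst + p.snd.fst) fun i => add_nonneg (hp.2 i) (hp.2 i)
    have h3 : inner ℝ (G.lap p.snd.snd) p.snd.fst = 0 := by
      rw [hG.inner_lap_left, hlap, inner_zero_right]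
    rw [zero_sub, inner_neg_right, inner_add_left, inner_neg_left, h3] at h1
    rw [add_sub_cancel_right, inner_add_left, inner_neg_left, h3] at h2
    linarith

/-- With consensual multipliers the first order conditions imply the variational inequality. -/
theorem FirstOrder.mem_solVI (hG : G.Standing) {z : G.Z} {lam : Euc N} (h : G.FirstOrder z lam) :
    z ∈ solVI G.Xi G.g := by
  have hfeas : G.loadₗ z ≤ G.b := by
    have := h.feasible
    rw [sum_B_sub_bloc] at this
    linarith
  refine ⟨⟨h.mem, hfeas⟩, fun y hy => ?_⟩
  have hc := hG.eq_of_inner_lap_self (v := lam) (by rw [h.consensus, inner_zero_left])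
  obtain ⟨i₀⟩ := hG.graph_connected.nonempty
  have hsum : ∀ v : Euc N, inner ℝ v lam = lam i₀ * ∑ i, v i := fun v => by
    simp only [PiLp.inner_apply, RCLike.inner_apply, conj_trivial, hc _ i₀, Finset.mul_sum]
  have h1 := h.stationary y hy.1
  have h2 := h.complementary
  rw [hsum, sum_B_sub_bloc] at h2
  rw [inner_neg_left, inner_add_left, inner_BT, real_inner_comm (G.B (y - z)), hsum,
    ← loadₗ_apply, map_sub] at h1
  have h3 : lam i₀ * (G.loadₗ y - G.b) ≤ 0 :=
    mul_nonpos_of_nonneg_of_nonpos (h.lam_nonneg i₀) (sub_nonpos.2 hy.2)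
  rw [real_inner_comm]
  linarith

/-! ### Identification of the limit -/

theorem sum_rhsLam_ge (hG : G.Standing) (z : G.Z) (lam zeta : Euc N) :
    G.loadₗ z - G.b ≤ ∑ i, G.rhsLam z lam zeta i := by
  have h : ∀ i, (G.B z - G.bloc) i - G.lap lam i - G.lap zeta i ≤ G.rhsLam z lam zeta i := fun i => by
    have := le_projOnto_nonnegOrthant
      (lam + G.B z - G.bloc - G.lap lam - G.lap zeta) i
    simp only [rhsLam, PiLp.sub_apply, PiLp.add_apply] at this ⊢
    linarith
  refine le_trans (le_of_eq ?_) (Finset.sum_le_sum fun i _ => h i)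
  rw [Finset.sum_sub_distrib, Finset.sum_sub_distrib, hG.sum_lap, hG.sum_lap, sum_B_sub_bloc,
    sub_zero, sub_zero]

/-- A solution starts at an equilibrium if its action profile, its (consensual) multipliers and the
weighted load are constant: then `⟪T (v 0), v s⟫` is constant in `s`, while its derivative at `0` is at
most `-‖v' 0‖²`. -/
theorem projField_eq_zero_of_const {v : ℝ → G.State}
    (hP : IsProjectionOn G.stateProj G.stateSet)
    (hv : IsProjSolution G.stateProj G.stateOp G.stateSet v) {x : Profile N n} {l : Euc N} {c : ℝ}
    (hx : ∀ s, 0 ≤ s → G.xPart (v s).fst = x) (hl : ∀ s, 0 ≤ s → (v s).snd.fst = l)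
    (hlap : G.lap l = 0) (hc : ∀ s, 0 ≤ s → inner ℝ l (G.B (v s).fst) = c) :
    projField G.stateProj G.stateOp (v 0) = 0 := by
  have hconst : ∀ s ∈ Ici (0 : ℝ), inner ℝ (G.stateOp (v 0)) (v s) = inner ℝ (G.pseudoGrad x) x + c
      + inner ℝ (-G.B (v 0).fst + G.bloc + G.lap l + G.lap (v 0).snd.snd) l := fun s hs => by
    rw [inner_stateOp, hl 0 le_rfl, hl s hs, inner_add_left, inner_g, inner_BT, hx 0 le_rfl,
      hx s hs, hc s hs, hlap, neg_zero, inner_zero_left, add_zero]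
  have h1 := (innerSL ℝ (G.stateOp (v 0))).hasFDerivAt.comp_hasDerivWithinAt 0 (hv.deriv 0 le_rfl)
  have h2 := (hasDerivWithinAt_const (0 : ℝ) (Ici 0) _).congr hconst (hconst 0 (mem_Ici.2 le_rfl))
  have h3 : inner ℝ (G.stateOp (v 0)) (projField G.stateProj G.stateOp (v 0)) = 0 :=
    (uniqueDiffWithinAt_Ici (0 : ℝ)).eq_deriv _ h1 h2
  have h4 := norm_projField_sq_le (T := G.stateOp) hP (hv.mem 0 le_rfl)
  rw [← neg_sub (G.stateProj _), inner_neg_right] at h4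
  change _ ≤ -inner ℝ (G.stateOp (v 0)) (projField G.stateProj G.stateOp (v 0)) at h4
  rw [h3, neg_zero] at h4
  exact norm_eq_zero.1 (pow_eq_zero_iff two_ne_zero |>.1 (le_antisymm h4 (sq_nonneg _)))

/-- Every solution of the projected flow accumulates at an equilibrium. -/
theorem exists_equilibrium_limit (hG : G.Standing) {J : Set (Σ i, Fin (G.q i))}
    (hJ : G.SignConstraints J) {z : G.Z} {μ : ℝ} (hk : G.IsKKT z μ)
    (hP : IsProjectionOn G.stateProj G.stateSet) {K : NNReal}
    (hT : LipschitzOnWith K G.stateOp G.stateSet) {u : ℝ → G.State}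
    (hu : IsProjSolution G.stateProj G.stateOp G.stateSet u) :
    ∃ (p : G.State) (𝒰 : Ultrafilter ℝ), projField G.stateProj G.stateOp p = 0 ∧
      (𝒰 : Filter ℝ) ≤ atTop ∧ Tendsto u 𝒰 (𝓝 p) := by
  have hmono : ∀ u ∈ G.stateSet, ∀ v ∈ G.stateSet,
      0 ≤ inner ℝ (G.stateOp u - G.stateOp v) (u - v) :=
    fun u hu v hv => stateOp_monotone hG hu hv
  obtain ⟨p₀, hp₀, hp₀z, hp₀c, hvi₀, -⟩ := hk.exists_state hG
  have hR : ∀ t, 0 ≤ t → ‖u t - p₀‖ ≤ √(2 * gapLyapunov G.stateProj G.stateOp p₀ (u 0)) :=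
    fun t ht => hu.norm_sub_le hP hT hmono hp₀ hvi₀ ht
  set R := √(2 * gapLyapunov G.stateProj G.stateOp p₀ (u 0))
  obtain ⟨i₀⟩ := hG.graph_connected.nonempty
  -- the total multiplier as a continuous functional
  let Λ : G.State →ₗ[ℝ] ℝ :=
    { toFun := fun w => ∑ i, w.snd.fst i
      map_add' := fun a b => Finset.sum_add_distrib
      map_smul' := fun c a => (Finset.mul_sum _ _ _).symm }
  let ΛL : G.State →L[ℝ] ℝ := LinearMap.toContinuousLinearMap Λ
  have hΛ : ∀ w, ΛL w = ∑ i, w.snd.fst i := fun _ => rfl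
  have hbd : ∀ t, 0 ≤ t → |ΛL (u t)| ≤ ‖ΛL‖ * (R + ‖p₀‖) := fun t ht => by
    refine (ΛL.le_opNorm (u t)).trans ?_
    gcongr
    linarith [norm_sub_norm_le (u t) p₀, hR t ht]
  have hle : IsBoundedUnder (· ≤ ·) atTop fun t => ΛL (u t) :=
    ⟨_, eventually_map.2 ((eventually_ge_atTop 0).mono fun t ht => (abs_le.1 (hbd t ht)).2)⟩
  have hge : IsBoundedUnder (· ≥ ·) atTop fun t => ΛL (u t) :=
    ⟨_, eventually_map.2 ((eventually_ge_atTop 0).mono fun t ht => (abs_le.1 (hbd t ht)).1)⟩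
  -- a limit solution whose total multiplier is the largest limit value
  set a := limsup (fun t => ΛL (u t)) atTop
  have hcl : MapClusterPt a atTop fun t => ΛL (u t) :=
    ClusterPt.limsSup hge.isCobounded_flip hle
  obtain ⟨𝒰, h𝒰, ha⟩ := mapClusterPt_iff_ultrafilter.1 hcl
  obtain ⟨v, hv, hlim⟩ := hu.exists_limit_solution hP (isClosed_stateSet hG hJ) hT hp₀ hR 𝒰 h𝒰
  have hlim0 : Tendsto u 𝒰 (𝓝 (v 0)) := by simpa using hlim 0 le_rfl
  have hv0 : ΛL (v 0) = a :=
    tendsto_nhds_unique ((ΛL.continuous.tendsto _).comp hlim0) ha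
  have hva : ∀ s, 0 ≤ s → ΛL (v s) ≤ a := fun s hs => by
    refine le_of_forall_gt_imp_ge_of_dense fun r hr => ?_
    have hev : ∀ᶠ t in (𝒰 : Filter ℝ), ΛL (u (t + s)) < r :=
      h𝒰 ((tendsto_atTop_add_const_right atTop s tendsto_id).eventually
        (eventually_lt_of_limsup_lt hr hle))
    exact le_of_tendsto ((ΛL.continuous.tendsto _).comp (hlim s hs)) (hev.mono fun t ht => ht.le)
  -- LaSalle: both parts of the dissipation vanish on the limit solution
  have hdiss : ∀ p ∈ G.stateSet, (∀ y ∈ G.stateSet, 0 ≤ inner ℝ (G.stateOp p) (y - p)) →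
      ∀ s, 0 ≤ s → inner ℝ (G.stateOp (v s) - G.stateOp p) (v s - p) ≤ 0 ∧
        inner ℝ (G.stateOp p) (v s - p) ≤ 0 := fun p hp hvi s hs => by
    have h1 := hu.inner_limit_le_zero hP hT hmono hp hvi hv h𝒰 hlim hs
    have h2 := hmono _ (hv.mem s hs) p hp
    have h3 := hvi _ (hv.mem s hs)
    have h4 : inner ℝ (G.stateOp (v s) - G.stateOp p) (v s - p)
        = inner ℝ (G.stateOp (v s)) (v s - p) - inner ℝ (G.stateOp p) (v s - p) :=
      inner_sub_left _ _ _
    constructor <;> linarith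
  have hx : ∀ s, 0 ≤ s → G.xPart (v s).fst = G.xPart z := fun s hs => by
    have h1 := (hdiss p₀ hp₀ hvi₀ s hs).1
    rw [inner_stateOp_sub hG] at h1
    rw [← hp₀z]
    refine hG.eq_of_inner_pseudoGrad (G.xPart_mem (hv.mem s hs).1) (G.xPart_mem hp₀.1) ?_
    linarith [hG.inner_lap_self_nonneg ((v s).snd.fst - p₀.snd.fst)]
  have hcons : ∀ s, 0 ≤ s → ∀ i j, (v s).snd.fst i = (v s).snd.fst j := fun s hs i j => by
    have h1 := (hdiss p₀ hp₀ hvi₀ s hs).1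
    rw [inner_stateOp_sub hG] at h1
    have h2 := hG.inner_pseudoGrad_nonneg (G.xPart_mem (hv.mem s hs).1) (G.xPart_mem hp₀.1)
    have h3 := hG.eq_of_inner_lap_self (v := (v s).snd.fst - p₀.snd.fst) (by linarith) i j
    simp only [PiLp.sub_apply] at h3
    linarith [hp₀c i j]
  refine ⟨v 0, 𝒰, ?_, h𝒰, hlim0⟩
  by_cases hslack : ∃ z₀ ∈ G.Omega, G.xPart z₀ = G.xPart z ∧ G.loadₗ z₀ < G.b
  · -- a slack solution forces the multipliers to vanish
    obtain ⟨z₀, hz₀, hz₀x, hz₀b⟩ := hslack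
    have hk₀ := hk.of_slack hz₀ hz₀x hz₀b
    obtain ⟨p, hp, -, -, hvi, hform⟩ := hk₀.exists_state hG
    have hN : (0 : ℝ) < N := by exact_mod_cast i₀.pos
    have hzero : ∀ s, 0 ≤ s → (v s).snd.fst = 0 := fun s hs => by
      have h1 := (hdiss p hp hvi s hs).2
      rw [hform] at h1
      have h2 := hk₀.stationary _ (hv.mem s hs).1
      have h3 : ∑ i, (v s).snd.fst i ≤ 0 := by
        by_contra! hpos
        have := mul_pos (div_pos (sub_pos.2 hz₀b) hN) hpos
        linarith
      have h4 := (Finset.sum_eq_zero_iff_of_nonneg fun i _ => (hv.mem s hs).2 i).1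
        (le_antisymm h3 (Finset.sum_nonneg fun i _ => (hv.mem s hs).2 i))
      ext i
      exact h4 i (Finset.mem_univ i)
    exact projField_eq_zero_of_const hP hv hx hzero (map_zero G.lapₗ)
      (fun s _ => inner_zero_left _)
  · -- otherwise the total multiplier cannot decrease, and it starts at its largest value
    push Not at hslack
    have hload : ∀ s, 0 ≤ s → G.b ≤ G.loadₗ (v s).fst := fun s hs =>
      hslack _ (hv.mem s hs).1 (hx s hs)
    have hder : ∀ s, 0 ≤ s → HasDerivWithinAt (fun s => ΛL (v s))
        (∑ i, G.rhsLam (v s).fst (v s).snd.fst (v s).snd.snd i) (Ici 0) s := fun s hs => by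
      have h1 := ΛL.hasFDerivAt.comp_hasDerivWithinAt s (hv.deriv s hs)
      rw [projField_state] at h1
      exact h1
    have hmon : MonotoneOn (fun s => ΛL (v s)) (Ici 0) := by
      refine monotoneOn_of_hasDerivWithinAt_nonneg (convex_Ici 0)
        (fun s hs => (hder s hs).continuousWithinAt)
        (fun s hs => (hder s (interior_subset hs)).mono interior_subset) fun s hs => ?_
      exact (sub_nonneg.2 (hload s (interior_subset hs))).trans (sum_rhsLam_ge hG _ _ _)
    have hconst : ∀ s, 0 ≤ s → ΛL (v s) = a := fun s hs =>
      le_antisymm (hva s hs) (hv0 ▸ hmon (mem_Ici.2 le_rfl) (mem_Ici.2 hs) hs)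
    have hloadb : ∀ s, 0 ≤ s → G.loadₗ (v s).fst = G.b := fun s hs => by
      have h1 : HasDerivWithinAt (fun s => ΛL (v s)) 0 (Ici 0) s :=
        (hasDerivWithinAt_const s (Ici 0) a).congr (fun r hr => hconst r hr) (hconst s hs)
      have h2 := (uniqueDiffOn_Ici (0 : ℝ) s hs).eq_deriv _ (hder s hs) h1
      have h3 := sum_rhsLam_ge hG (v s).fst (v s).snd.fst (v s).snd.snd
      exact le_antisymm (by linarith) (hload s hs)
    have hN : (N : ℝ) ≠ 0 := by exact_mod_cast i₀.pos.ne'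
    have hlam : ∀ s, 0 ≤ s → ∀ i, (v s).snd.fst i = a / N := fun s hs i => by
      have h1 := hconst s hs
      rw [hΛ, Finset.sum_congr rfl fun j _ => hcons s hs j i] at h1
      simp only [Finset.sum_const, Finset.card_univ, Fintype.card_fin, nsmul_eq_mul] at h1
      rw [eq_div_iff hN, mul_comm]
      exact h1
    refine projField_eq_zero_of_const (l := WithLp.toLp 2 fun _ => a / N) (c := G.b * (a / N))
      hP hv hx (fun s hs => by ext i; exact hlam s hs i)
      (lap_eq_zero_of_consensus fun _ _ => rfl) fun s hs => ?_
    rw [← hloadb s hs, loadₗ_apply, Finset.sum_mul]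
    simp [PiLp.inner_apply]

end GameData

theorem theorem1 {N n : ℕ} (G : GameData N n)
    (hG : G.Standing) (hP : G.Inscribed)
    (hF : LocallyLipschitzOn G.ThetaProd G.pseudoGrad)
    (hS : (∀ i, G.Sdual i = Set.univ) ∨ (∀ i, G.Sdual i = nonnegOrthant (G.q i)))
    (z : ℝ → G.Z) (lam zeta : ℝ → Euc N) (htraj : G.IsTrajectory z lam zeta) :
    Bornology.IsBounded {s : G.Z × Euc N × Euc N | ∃ t : ℝ, 0 ≤ t ∧ s = (z t, lam t, zeta t)} ∧
    ∃ (z' : G.Z) (lam' zeta' : Euc N),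
      G.IsEquilibrium z' lam' zeta' ∧
      Tendsto z atTop (𝓝 z') ∧ Tendsto lam atTop (𝓝 lam') ∧ Tendsto zeta atTop (𝓝 zeta') ∧
      z' ∈ solVI G.Xi G.g ∧ G.FirstOrder z' lam' := by
  obtain ⟨J, hJ⟩ := G.exists_signConstraints hS
  obtain ⟨zs, μ, hk⟩ := GameData.exists_isKKT hG hP hF hJ
  have hproj := GameData.isProjectionOn_stateProj hG hJ ⟨_, htraj.z_init⟩
  obtain ⟨K, hT⟩ := GameData.exists_lipschitzOnWith_stateOp hG hF
  have hmono : ∀ u ∈ G.stateSet, ∀ v ∈ G.stateSet,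
      0 ≤ inner ℝ (G.stateOp u - G.stateOp v) (u - v) :=
    fun u hu v hv => GameData.stateOp_monotone hG hu hv
  have hu := htraj.isProjSolution hG hJ
  refine ⟨?_, ?_⟩
  · obtain ⟨p, hp, -, -, hvi, -⟩ := hk.exists_state hG
    rw [isBounded_iff_forall_norm_le]
    refine ⟨√(2 * gapLyapunov G.stateProj G.stateOp p (G.mkState (z 0) (lam 0) (zeta 0))) + ‖p‖, ?_⟩
    rintro _ ⟨t, ht, rfl⟩
    have h1 := hu.norm_sub_le hproj hT hmono hp hvi ht
    have h2 := norm_sub_norm_le (G.mkState (z t) (lam t) (zeta t)) p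
    have h3 : ‖z t‖ ≤ ‖G.mkState (z t) (lam t) (zeta t)‖ :=
      WithLp.norm_fst_le _ (G.mkState (z t) (lam t) (zeta t))
    have h4 : ‖(G.mkState (z t) (lam t) (zeta t)).snd‖ ≤ ‖G.mkState (z t) (lam t) (zeta t)‖ :=
      WithLp.norm_snd_le _ (G.mkState (z t) (lam t) (zeta t))
    have h5 : ‖lam t‖ ≤ ‖(G.mkState (z t) (lam t) (zeta t)).snd‖ :=
      WithLp.norm_fst_le _ (G.mkState (z t) (lam t) (zeta t)).snd
    have h6 : ‖zeta t‖ ≤ ‖(G.mkState (z t) (lam t) (zeta t)).snd‖ :=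
      WithLp.norm_snd_le _ (G.mkState (z t) (lam t) (zeta t)).snd
    refine norm_prod_le_iff.2 ⟨?_, norm_prod_le_iff.2 ⟨?_, ?_⟩⟩ <;> linarith
  · obtain ⟨p, 𝒰, hp, h𝒰, hlim⟩ := GameData.exists_equilibrium_limit hG hJ hk hproj hT hu
    have hconv := hu.tendsto_of_ultrafilter hproj hT hmono hp h𝒰 hlim
    obtain ⟨hpmem, hvi⟩ := vi_of_projField_eq_zero hproj hp
    have hfst := ((WithLp.fstL 2 ℝ G.Z (WithLp 2 (Euc N × Euc N))).continuous.tendsto p).comp hconv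
    have hsnd := ((WithLp.sndL 2 ℝ G.Z (WithLp 2 (Euc N × Euc N))).continuous.tendsto p).comp hconv
    rw [GameData.projField_state] at hp
    have heq : G.IsEquilibrium p.fst p.snd.fst p.snd.snd :=
      ⟨congrArg (fun w : G.State => w.fst) hp, congrArg (fun w : G.State => w.snd.fst) hp,
        congrArg (fun w : G.State => w.snd.snd) hp⟩
    have hfo := GameData.firstOrder_of_vi hG hpmem hvi heq.zeta_eq
    exact ⟨p.fst, p.snd.fst, p.snd.snd, heq, hfst,
      ((WithLp.fstL 2 ℝ (Euc N) (Euc N)).continuous.tendsto _).comp hsnd,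
      ((WithLp.sndL 2 ℝ (Euc N) (Euc N)).continuous.tendsto _).comp hsnd,
      hfo.mem_solVI hG, hfo⟩
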